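/- Let $H$ be an infinite-dimensional complex Hilbert space (not necessarily separable), and let $B(H)$ be the algebra of bounded linear operators on $H$. For $0<p<\infty$ let $C_p$ be the Schatten ideal of all compact operators $x\in B(H)$ with $\operatorname{tr}(|x|^p)<\infty$, where $|x|=(x^*x)^{1/2}$ and $\operatorname{tr}$ is the standard trace on positive operators. A mapping $\delta\colon C_p\to C_r$ is called a derivation if it is linear and $\delta(xy)=\delta(x)y+x\delta(y)$ for all $x,y\in C_p$. For $a\in B(H)$ put $\delta_a(x)=ax-xa$. (i) If $0<p\le r<\infty$, then the derivations $C_p\to C_r$ are exactly the mappings $\delta_a|_{C_p}$ with $a\in B(H)$ (in particular each such mapping takes its values in $C_r$). (ii) If $0<r<p<\infty$, then the derivations $C_p\to C_r$ are exactly the mappings $\delta_a|_{C_p}$ with $a\in C_q$, where $\frac1q=\frac1r-\frac1p$ (in particular each such mapping takes its values in $C_r$). -/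

import Mathlib

open scoped ENNReal InnerProductSpace

namespace Schatten

variable {H : Type*} [NormedAddCommGroup H] [InnerProductSpace ℂ H] [CompleteSpace H]

/-- The standard trace `tr T = ∑ ⟪e, T e⟫ ∈ [0, ∞]` of a positive bounded operator `T`, where `e`
runs over an orthonormal basis (Hilbert basis) of `H`; by `trace_eq_tsum` the value does not depend
on the basis. (It is used for positive operators only.) -/
noncomputable def trace (T : H →L[ℂ] H) : ℝ≥0∞ :=
  ∑' e : (exists_hilbertBasis ℂ H).choose, ENNReal.ofReal (RCLike.re ⟪(e : H), T (e : H)⟫_ℂ)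

/-- `x ∈ C_p`: the operator `x` is compact and `tr (|x| ^ p) < ∞`. Here `CFC.abs x` is
`|x| = (x⋆ x) ^ (1/2)`, and the real power is the one of the continuous functional calculus. -/
def IsSchatten (p : ℝ) (x : H →L[ℂ] H) : Prop :=
  IsCompactOperator x ∧ trace (CFC.abs x ^ p) < ∞

set_option linter.unusedSectionVars false in
theorem hasSum_norm_sq {ι : Type*} (b : HilbertBasis ι ℂ H) (v : H) :
    HasSum (fun i => ‖⟪b i, v⟫_ℂ‖ ^ 2) (‖v‖ ^ 2) := by
  have h := (b.hasSum_inner_mul_inner v v).mapL Complex.reCLM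
  have h2 : Complex.reCLM ⟪v, v⟫_ℂ = ‖v‖ ^ 2 := by
    simpa using inner_self_eq_norm_sq (𝕜 := ℂ) v
  rw [h2] at h
  refine h.congr_fun (fun i => ?_) |> fun h => h
  rw [← inner_conj_symm v (b i), RCLike.conj_mul]
  norm_cast

theorem tsum_norm_sq {ι : Type*} (b : HilbertBasis ι ℂ H) (v : H) :
    ∑' i, ENNReal.ofReal (‖⟪b i, v⟫_ℂ‖ ^ 2) = ENNReal.ofReal (‖v‖ ^ 2) := by
  rw [← (hasSum_norm_sq b v).tsum_eq,
    ENNReal.ofReal_tsum_of_nonneg (fun _ => by positivity) (hasSum_norm_sq b v).summable]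

theorem tsum_norm_map_sq_comm {ι κ : Type*} (b : HilbertBasis ι ℂ H) (c : HilbertBasis κ ℂ H)
    (S : H →L[ℂ] H) (hS : IsSelfAdjoint S) :
    ∑' i, ENNReal.ofReal (‖S (b i)‖ ^ 2) = ∑' j, ENNReal.ofReal (‖S (c j)‖ ^ 2) := by
  simp_rw [← tsum_norm_sq c (S (b _)), ← tsum_norm_sq b (S (c _))]
  rw [ENNReal.tsum_comm]
  congr! 6 with j i
  rw [← norm_inner_symm, ← ContinuousLinearMap.adjoint_inner_right,
    ContinuousLinearMap.isSelfAdjoint_iff'.mp hS]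

theorem tsum_re_inner_eq {ι κ : Type*} (b : HilbertBasis ι ℂ H) (c : HilbertBasis κ ℂ H)
    (T : H →L[ℂ] H) (hT : 0 ≤ T) :
    ∑' i, ENNReal.ofReal (RCLike.re ⟪b i, T (b i)⟫_ℂ) =
      ∑' j, ENNReal.ofReal (RCLike.re ⟪c j, T (c j)⟫_ℂ) := by
  have hS : IsSelfAdjoint (CFC.sqrt T) := (CFC.sqrt_nonneg T).isSelfAdjoint
  have key : ∀ v : H, RCLike.re ⟪v, T v⟫_ℂ = ‖CFC.sqrt T v‖ ^ 2 := by
    intro v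
    conv_lhs => rw [← CFC.sqrt_mul_sqrt_self T hT]
    rw [← inner_self_eq_norm_sq (𝕜 := ℂ), mul_apply_eq_comp,
      ← ContinuousLinearMap.adjoint_inner_left, ContinuousLinearMap.isSelfAdjoint_iff'.mp hS]
  simp_rw [key]
  exact tsum_norm_map_sq_comm b c _ hS

/-- The trace of a positive operator may be computed in any orthonormal basis. -/
theorem trace_eq_tsum {ι : Type*} (b : HilbertBasis ι ℂ H) (T : H →L[ℂ] H) (hT : 0 ≤ T) :
    trace T = ∑' i, ENNReal.ofReal (RCLike.re ⟪b i, T (b i)⟫_ℂ) := by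
  obtain ⟨c, hc⟩ := (exists_hilbertBasis ℂ H).choose_spec
  rw [← tsum_re_inner_eq c b T hT, hc, trace]

theorem cfc_apply_eigenvector (T : H →L[ℂ] H) (hT : IsSelfAdjoint T) (v : H) (s : ℝ) (hv : v ≠ 0)
    (h : T v = (s : ℂ) • v) (f : ℝ → ℝ) (hf : Continuous f) :
    cfc f T v = (f s : ℂ) • v := by
  have hs : s ∈ spectrum ℝ T := by
    rw [spectrum.mem_iff]
    intro hu
    obtain ⟨w, hw⟩ := hu.exists_left_inv
    apply hv
    have : (w * (algebraMap ℝ (H →L[ℂ] H) s - T)) v = v := by rw [hw]; rfl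
    rw [← this, mul_apply_eq_comp]
    have : (algebraMap ℝ (H →L[ℂ] H) s - T) v = 0 := by
      rw [sub_apply, h, Algebra.algebraMap_eq_smul_one]
      simp
    rw [this, map_zero]
  have main : ∀ g : C(spectrum ℝ T, ℝ), cfcHom hT g v = (g ⟨s, hs⟩ : ℂ) • v := by
    intro g
    induction g using ContinuousMap.induction_on_of_compact with
    | const r =>
      have : cfcHom hT (ContinuousMap.const (spectrum ℝ T) r) = algebraMap ℝ (H →L[ℂ] H) r :=
        AlgHomClass.commutes (cfcHom hT) r
      rw [this, Algebra.algebraMap_eq_smul_one]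
      simp
    | id =>
      rw [cfcHom_id (R := ℝ) hT, h]
      simp
    | star_id =>
      rw [map_star, cfcHom_id (R := ℝ) hT, hT.star_eq, h]
      simp
    | add f g hf hg => simp [hf, hg, add_smul]
    | mul f g hf hg =>
      rw [map_mul, mul_apply_eq_comp, hg, map_smul, hf, smul_smul, ContinuousMap.mul_apply,
        Complex.ofReal_mul, mul_comm]
    | frequently f hf =>
      have hc : IsClosed {g : C(spectrum ℝ T, ℝ) | cfcHom hT g v = (g ⟨s, hs⟩ : ℂ) • v} := by
        refine isClosed_eq ?_ ?_
        · have := cfcHom_continuous (R := ℝ) hT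
          fun_prop
        · have : Continuous fun g : C(spectrum ℝ T, ℝ) => g ⟨s, hs⟩ :=
            continuous_eval_const _
          fun_prop
      exact hc.mem_of_frequently_of_tendsto hf Filter.tendsto_id
  rw [cfc_apply f T hT hf.continuousOn, main]
  rfl

/-- A compact operator `x` has an orthonormal basis of eigenvectors of `x⋆ x`. -/
theorem exists_eigenbasis (x : H →L[ℂ] H) (hx : IsCompactOperator x) :
    ∃ (w : Set H) (b : HilbertBasis w ℂ H),
      ∀ i, (star x * x) (b i) = ((‖x (b i)‖ ^ 2 : ℝ) : ℂ) • b i := by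
  set T := star x * x with hTdef
  have hT : IsSelfAdjoint T := IsSelfAdjoint.star_mul_self x
  have hsymm : (T : H →ₗ[ℂ] H).IsSymmetric := hT.isSymmetric
  have hTc : IsCompactOperator T := hx.clm_comp (star x)
  have hbot := ContinuousLinearMap.orthogonalComplement_iSup_eigenspaces_eq_bot hTc hsymm
  have horth := hsymm.orthogonalFamily_eigenspaces
  have hcl : ∀ μ : ℂ, CompleteSpace (Module.End.eigenspace (T : H →ₗ[ℂ] H) μ) := by
    intro μ
    have : IsClosed (Module.End.eigenspace (T : H →ₗ[ℂ] H) μ : Set H) := by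
      have : (Module.End.eigenspace (T : H →ₗ[ℂ] H) μ : Set H) = {v | T v = μ • v} := by
        ext v; simp
      rw [this]
      exact isClosed_eq (by fun_prop) (by fun_prop)
    exact this.completeSpace_coe
  choose w c hc using fun μ : ℂ =>
    exists_hilbertBasis ℂ (Module.End.eigenspace (T : H →ₗ[ℂ] H) μ)
  have ho := horth.orthonormal_sigma_orthonormal (fun μ => (c μ).orthonormal)
  set f : (Σ μ : ℂ, w μ) → H := fun a => ((c a.1 a.2 : Module.End.eigenspace (T : H →ₗ[ℂ] H) a.1) : H)
  have hof : Orthonormal ℂ f := ho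
  have hfe : ∀ a, T (f a) = a.1 • f a := fun a =>
    Module.End.mem_eigenspace_iff.mp (c a.1 a.2).2
  have hspan : (Submodule.span ℂ (Set.range f))ᗮ = ⊥ := by
    rw [eq_bot_iff, ← hbot]
    intro v hv
    rw [Submodule.mem_orthogonal] at hv ⊢
    intro u hu
    rw [← Submodule.mem_orthogonal_singleton_iff_inner_left]
    revert u
    change (⨆ μ, Module.End.eigenspace (T : H →ₗ[ℂ] H) μ) ≤ (ℂ ∙ v)ᗮ
    refine iSup_le (fun μ u hu => ?_)
    rw [Submodule.mem_orthogonal_singleton_iff_inner_left]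
    have h1 := ((c μ).hasSum_inner_mul_inner ⟨u, hu⟩
      ((Module.End.eigenspace (T : H →ₗ[ℂ] H) μ).orthogonalProjectionOnto v)).tsum_eq
    have h2 : ∀ i, ⟪c μ i, (Module.End.eigenspace (T : H →ₗ[ℂ] H) μ).orthogonalProjectionOnto v⟫_ℂ
        = 0 := by
      intro i
      rw [Submodule.inner_orthogonalProjectionOnto_eq_of_mem_left]
      exact hv _ (Submodule.subset_span ⟨⟨μ, i⟩, rfl⟩)
    simp only [h2, mul_zero, tsum_zero] at h1
    rw [Submodule.inner_orthogonalProjectionOnto_eq_of_mem_left] at h1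
    exact h1.symm
  have hrange : ∀ i : Set.range f, T (i : H) = ((‖x (i : H)‖ ^ 2 : ℝ) : ℂ) • (i : H) := by
    rintro ⟨_, a, rfl⟩
    have h1 : ⟪f a, T (f a)⟫_ℂ = a.1 := by
      rw [hfe, inner_smul_right, inner_self_eq_norm_sq_to_K, hof.1 a]; simp
    have h2 : ⟪f a, T (f a)⟫_ℂ = ((‖x (f a)‖ ^ 2 : ℝ) : ℂ) := by
      rw [hTdef, mul_apply_eq_comp, ContinuousLinearMap.star_eq_adjoint,
        ContinuousLinearMap.adjoint_inner_right, inner_self_eq_norm_sq_to_K]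
      norm_cast
    simp only
    rw [← h2, h1, hfe]
  have hor : Orthonormal ℂ ((↑) : Set.range f → H) := hof.toSubtypeRange
  refine ⟨Set.range f, HilbertBasis.mkOfOrthogonalEqBot hor (by rwa [Subtype.range_coe]), ?_⟩
  intro i
  rw [HilbertBasis.coe_mkOfOrthogonalEqBot]
  exact hrange i

theorem hasSum_norm_map_sq {ι : Type*} (b : HilbertBasis ι ℂ H) (x : H →L[ℂ] H)
    (hb : ∀ i, (star x * x) (b i) = ((‖x (b i)‖ ^ 2 : ℝ) : ℂ) • b i) (v : H) :
    HasSum (fun i => ‖x (b i)‖ ^ 2 * ‖⟪b i, v⟫_ℂ‖ ^ 2) (‖x v‖ ^ 2) := by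
  have h := (b.hasSum_inner_mul_inner v ((star x * x) v)).mapL Complex.reCLM
  have h2 : Complex.reCLM ⟪v, (star x * x) v⟫_ℂ = ‖x v‖ ^ 2 := by
    rw [mul_apply_eq_comp, ContinuousLinearMap.star_eq_adjoint,
      ContinuousLinearMap.adjoint_inner_right]
    simpa using inner_self_eq_norm_sq (𝕜 := ℂ) (x v)
  rw [h2] at h
  convert h using 2 with i
  have hs : IsSelfAdjoint (star x * x) := IsSelfAdjoint.star_mul_self x
  have h3 : ⟪b i, (star x * x) v⟫_ℂ = ((‖x (b i)‖ ^ 2 : ℝ) : ℂ) * ⟪b i, v⟫_ℂ := by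
    rw [← ContinuousLinearMap.adjoint_inner_left, ContinuousLinearMap.isSelfAdjoint_iff'.mp hs, hb,
      inner_smul_left, Complex.conj_ofReal]
  rw [h3, mul_left_comm, ← inner_conj_symm v (b i), RCLike.conj_mul]
  rw [Complex.reCLM_apply, Complex.re_ofReal_mul]
  norm_cast

theorem norm_map_le_of_orthogonal {ι : Type*} (b : HilbertBasis ι ℂ H) (x : H →L[ℂ] H)
    (hb : ∀ i, (star x * x) (b i) = ((‖x (b i)‖ ^ 2 : ℝ) : ℂ) • b i) (t : ℝ) (ht : 0 ≤ t) (v : H)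
    (hv : ∀ i, t < ‖x (b i)‖ → ⟪b i, v⟫_ℂ = 0) : ‖x v‖ ≤ t * ‖v‖ := by
  refine le_of_sq_le_sq ?_ (by positivity)
  rw [mul_pow]
  refine hasSum_le (fun i => ?_) (hasSum_norm_map_sq b x hb v) ((hasSum_norm_sq b v).mul_left _)
  by_cases h : t < ‖x (b i)‖
  · simp [hv i h]
  · gcongr
    exact not_lt.mp h

theorem lt_norm_map_of_mem_span {ι : Type*} (b : HilbertBasis ι ℂ H) (x : H →L[ℂ] H)
    (hb : ∀ i, (star x * x) (b i) = ((‖x (b i)‖ ^ 2 : ℝ) : ℂ) • b i) (t : ℝ) (ht : 0 ≤ t) (v : H)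
    (hv : ∀ i, ‖x (b i)‖ ≤ t → ⟪b i, v⟫_ℂ = 0) (i : ι) (hi : ⟪b i, v⟫_ℂ ≠ 0) :
    t * ‖v‖ < ‖x v‖ := by
  refine lt_of_pow_lt_pow_left₀ 2 (by positivity) ?_
  rw [mul_pow]
  refine hasSum_lt (i := i) (fun j => ?_) ?_ ((hasSum_norm_sq b v).mul_left _)
    (hasSum_norm_map_sq b x hb v)
  · by_cases h : ‖x (b j)‖ ≤ t
    · simp [hv j h]
    · have := (not_le.mp h).le
      gcongr
  · have h : t < ‖x (b i)‖ := by
      by_contra h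
      exact hi (hv i (not_lt.mp h))
    have : 0 < ‖⟪b i, v⟫_ℂ‖ := norm_pos_iff.mpr hi
    gcongr

theorem card_le_card {ι : Type*} (b : HilbertBasis ι ℂ H) (x : H →L[ℂ] H)
    (hb : ∀ i, (star x * x) (b i) = ((‖x (b i)‖ ^ 2 : ℝ) : ℂ) • b i) (t : ℝ) (ht : 0 ≤ t)
    {κ : Type*} (S : Finset κ) (u : κ → H)
    (hS : ∀ v, (∀ k ∈ S, ⟪u k, v⟫_ℂ = 0) → ‖x v‖ ≤ t * ‖v‖)
    (F : Finset ι) (hF : ∀ i ∈ F, t < ‖x (b i)‖) : F.card ≤ S.card := by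
  classical
  by_contra! hlt
  let g : (F → ℂ) →ₗ[ℂ] H := Fintype.linearCombination ℂ (fun i : F => b i)
  let L : (F → ℂ) →ₗ[ℂ] (S → ℂ) := LinearMap.pi (fun k : S => (innerSL ℂ (u k) : H →ₗ[ℂ] ℂ) ∘ₗ g)
  have hker : LinearMap.ker L ≠ ⊥ := by
    apply LinearMap.ker_ne_bot_of_finrank_lt
    simpa using hlt
  obtain ⟨c, hc, hc0⟩ := (Submodule.ne_bot_iff _).mp hker
  have hg : ∀ j : ι, ⟪b j, g c⟫_ℂ = if h : j ∈ F then c ⟨j, h⟩ else 0 := by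
    intro j
    simp only [g, Fintype.linearCombination_apply, inner_sum, inner_smul_right,
      orthonormal_iff_ite.mp b.orthonormal, mul_ite, mul_one, mul_zero]
    split_ifs with h
    · rw [Finset.sum_eq_single ⟨j, h⟩]
      · simp
      · intro k _ hk
        rw [if_neg]
        rintro rfl
        exact hk rfl
      · simp
    · refine Finset.sum_eq_zero (fun k _ => if_neg ?_)
      rintro rfl
      exact h k.2
  have h1 : ‖x (g c)‖ ≤ t * ‖g c‖ := by
    apply hS
    intro k hk
    exact congrFun (LinearMap.mem_ker.mp hc) ⟨k, hk⟩
  obtain ⟨i, hi⟩ := Function.ne_iff.mp hc0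
  refine absurd h1 (not_le.mpr (lt_norm_map_of_mem_span b x hb t ht (g c) ?_ i ?_))
  · intro j hj
    rw [hg, dif_neg]
    intro hjF
    exact absurd (hF j hjF) (not_lt.mpr hj)
  · rw [hg, dif_pos i.2]
    exact hi

theorem count_le_count {ι κ : Type*} (b : HilbertBasis ι ℂ H) (x : H →L[ℂ] H)
    (hb : ∀ i, (star x * x) (b i) = ((‖x (b i)‖ ^ 2 : ℝ) : ℂ) • b i) (t : ℝ) (ht : 0 ≤ t)
    (S : Set κ) (u : κ → H)
    (hS : ∀ v, (∀ k ∈ S, ⟪u k, v⟫_ℂ = 0) → ‖x v‖ ≤ t * ‖v‖) :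
    {i | t < ‖x (b i)‖}.encard ≤ S.encard := by
  rcases S.finite_or_infinite with hfin | hinf
  · rw [hfin.encard_eq_coe_toFinset_card]
    by_contra! hlt
    obtain ⟨F, hFs, hFc⟩ := Set.exists_subset_encard_eq (Order.add_one_le_of_lt hlt)
    have hFf : F.Finite := Set.finite_of_encard_eq_coe (k := hfin.toFinset.card + 1) (by
      rw [hFc]; rfl)
    have := card_le_card b x hb t ht hfin.toFinset u
      (fun v hv => hS v (fun k hk => hv k (hfin.mem_toFinset.mpr hk))) hFf.toFinset
      (fun i hi => hFs (hFf.mem_toFinset.mp hi))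
    rw [hFf.encard_eq_coe_toFinset_card] at hFc
    have h2 : hFf.toFinset.card = hfin.toFinset.card + 1 := by exact_mod_cast hFc
    omega
  · rw [hinf.encard_eq]; exact le_top

theorem trace_abs_rpow {ι : Type*} (b : HilbertBasis ι ℂ H) (x : H →L[ℂ] H)
    (hb : ∀ i, (star x * x) (b i) = ((‖x (b i)‖ ^ 2 : ℝ) : ℂ) • b i) (p : ℝ) (hp : 0 < p) :
    trace (CFC.abs x ^ p) = ∑' i, ENNReal.ofReal (‖x (b i)‖ ^ p) := by
  have h1 : CFC.abs x ^ p = cfc (fun t : ℝ => t ^ (p / 2)) (star x * x) := by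
    have hp' : 0 < p.toNNReal := Real.toNNReal_pos.mpr hp
    have e := CFC.nnrpow_sqrt (a := star x * x) (x := p.toNNReal)
    rw [CFC.nnrpow_eq_rpow hp', CFC.nnrpow_eq_rpow (half_pos hp'), NNReal.coe_div,
      Real.coe_toNNReal p hp.le, NNReal.coe_ofNat] at e
    rw [CFC.abs, ← CFC.rpow_eq_cfc_real (star_mul_self_nonneg x)]
    exact e
  rw [trace_eq_tsum b _ CFC.rpow_nonneg]
  congr! 2 with i
  rw [h1, cfc_apply_eigenvector _ (IsSelfAdjoint.star_mul_self x) (b i) (‖x (b i)‖ ^ 2)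
    (b.orthonormal.ne_zero i) (hb i) _ (Real.continuous_rpow_const (by positivity)),
    inner_smul_right, inner_self_eq_norm_sq_to_K, b.orthonormal.1 i]
  have : (‖x (b i)‖ ^ 2) ^ (p / 2) = ‖x (b i)‖ ^ p := by
    rw [← Real.rpow_natCast, ← Real.rpow_mul (norm_nonneg _)]
    congr 1
    push_cast
    ring
  simp [this]

theorem tsum_rpow_eq {ι : Type*} (f : ι → ℝ) (hf : ∀ i, 0 ≤ f i) (p : ℝ) (hp : 0 < p) :
    ∑' i, ENNReal.ofReal (f i ^ p) = ENNReal.ofReal p *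
      ∫⁻ t in Set.Ioi (0 : ℝ), ({i | t < f i}.encard : ℝ≥0∞) * ENNReal.ofReal (t ^ (p - 1)) := by
  let _ : MeasurableSpace ι := ⊤
  rw [← MeasureTheory.lintegral_count, MeasureTheory.lintegral_rpow_eq_lintegral_meas_lt_mul
    _ (Filter.Eventually.of_forall hf) (by fun_prop) hp]
  simp_rw [MeasureTheory.Measure.count_apply (MeasurableSpace.measurableSet_top)]

theorem measurable_encard_lt {ι : Type*} (f : ι → ℝ) :
    Measurable fun t : ℝ => ({i | t < f i}.encard : ℝ≥0∞) := by
  refine Antitone.measurable (fun s t hst => ?_)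
  exact ENat.toENNReal_le.mpr (Set.encard_le_encard (fun i hi => lt_of_le_of_lt hst hi))

theorem tsum_rpow_lt_top {ι κ κ' : Type*} (f : ι → ℝ) (g : κ → ℝ) (h : κ' → ℝ)
    (hf : ∀ i, 0 ≤ f i) (hg : ∀ i, 0 ≤ g i) (hh : ∀ i, 0 ≤ h i) (p : ℝ) (hp : 0 < p)
    (c : ℝ) (hc : 0 < c)
    (hcount : ∀ t, 0 < t → {i | c * t < f i}.encard ≤ {i | t < g i}.encard + {i | t < h i}.encard)
    (hgp : ∑' i, ENNReal.ofReal (g i ^ p) < ∞) (hhp : ∑' i, ENNReal.ofReal (h i ^ p) < ∞) :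
    ∑' i, ENNReal.ofReal (f i ^ p) < ∞ := by
  have h1 : ∀ i, ENNReal.ofReal (f i ^ p) = ENNReal.ofReal (c ^ p) *
      ENNReal.ofReal ((f i / c) ^ p) := by
    intro i
    rw [← ENNReal.ofReal_mul (by positivity), ← Real.mul_rpow hc.le (div_nonneg (hf i) hc.le),
      mul_div_cancel₀ _ hc.ne']
  simp_rw [h1]
  rw [ENNReal.tsum_mul_left]
  refine ENNReal.mul_lt_top ENNReal.ofReal_lt_top ?_
  refine lt_of_le_of_lt ?_ (ENNReal.add_lt_top.mpr ⟨hgp, hhp⟩)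
  have hm : Measurable fun t : ℝ =>
      ({i | t < g i}.encard : ℝ≥0∞) * ENNReal.ofReal (t ^ (p - 1)) :=
    (measurable_encard_lt g).mul (by fun_prop)
  rw [tsum_rpow_eq _ (fun i => div_nonneg (hf i) hc.le) p hp, tsum_rpow_eq g hg p hp,
    tsum_rpow_eq h hh p hp, ← mul_add, ← MeasureTheory.lintegral_add_left hm]
  refine mul_le_mul' le_rfl ?_
  refine MeasureTheory.setLIntegral_mono' measurableSet_Ioi (fun t ht => ?_)
  rw [← add_mul]
  gcongr
  have h2 : {i | t < f i / c} = {i | c * t < f i} := by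
    ext i
    simp only [Set.mem_ofPred_eq]
    rw [lt_div_iff₀ hc, mul_comm]
  rw [h2]
  exact_mod_cast hcount t ht

namespace IsSchatten

theorem add {p : ℝ} (hp : 0 < p) {x y : H →L[ℂ] H} (hx : IsSchatten p x) (hy : IsSchatten p y) :
    IsSchatten p (x + y) := by
  have hz : IsCompactOperator (x + y) := hx.1.add hy.1
  obtain ⟨_, bx, hbx⟩ := exists_eigenbasis x hx.1
  obtain ⟨_, by', hby⟩ := exists_eigenbasis y hy.1
  obtain ⟨_, bz, hbz⟩ := exists_eigenbasis (x + y) hz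
  refine ⟨hz, ?_⟩
  have h1 := hx.2
  have h2 := hy.2
  rw [trace_abs_rpow bx x hbx p hp] at h1
  rw [trace_abs_rpow by' y hby p hp] at h2
  rw [trace_abs_rpow bz _ hbz p hp]
  refine tsum_rpow_lt_top _ _ _ (fun _ => norm_nonneg _) (fun _ => norm_nonneg _)
    (fun _ => norm_nonneg _) p hp 2 two_pos (fun t ht => ?_) h1 h2
  refine (count_le_count bz (x + y) hbz (2 * t) (by positivity)
    (bx '' {i | t < ‖x (bx i)‖} ∪ by' '' {i | t < ‖y (by' i)‖}) id (fun v hv => ?_)).trans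
    ((Set.encard_union_le _ _).trans (add_le_add (Set.encard_image_le _ _)
      (Set.encard_image_le _ _)))
  have e1 := norm_map_le_of_orthogonal bx x hbx t ht.le v
    (fun i hi => hv _ (Or.inl ⟨i, hi, rfl⟩))
  have e2 := norm_map_le_of_orthogonal by' y hby t ht.le v
    (fun i hi => hv _ (Or.inr ⟨i, hi, rfl⟩))
  calc ‖(x + y) v‖ ≤ ‖x v‖ + ‖y v‖ := norm_add_le _ _
    _ ≤ 2 * t * ‖v‖ := by linarith

theorem mul_mul {p : ℝ} (hp : 0 < p) {x : H →L[ℂ] H} (hx : IsSchatten p x) (a b : H →L[ℂ] H) :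
    IsSchatten p (a * x * b) := by
  have hz : IsCompactOperator (a * x * b) := (hx.1.clm_comp a).comp_clm b
  obtain ⟨_, bx, hbx⟩ := exists_eigenbasis x hx.1
  obtain ⟨_, bz, hbz⟩ := exists_eigenbasis (a * x * b) hz
  refine ⟨hz, ?_⟩
  have h1 := hx.2
  rw [trace_abs_rpow bx x hbx p hp] at h1
  rw [trace_abs_rpow bz _ hbz p hp]
  refine tsum_rpow_lt_top _ _ _ (fun _ => norm_nonneg _) (fun _ => norm_nonneg _)
    (fun _ => norm_nonneg _) p hp (‖a‖ * ‖b‖ + 1) (by positivity) (fun t ht => ?_) h1 h1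
  refine (count_le_count bz (a * x * b) hbz ((‖a‖ * ‖b‖ + 1) * t) (by positivity)
    {i | t < ‖x (bx i)‖} (fun i => star b (bx i)) (fun v hv => ?_)).trans le_self_add
  have e1 := norm_map_le_of_orthogonal bx x hbx t ht.le (b v) (fun i hi => by
    rw [← ContinuousLinearMap.adjoint_inner_left]
    exact hv i hi)
  calc ‖(a * x * b) v‖ ≤ ‖a‖ * ‖x (b v)‖ := a.le_opNorm _
    _ ≤ ‖a‖ * (t * (‖b‖ * ‖v‖)) := by
      have := b.le_opNorm v
      gcongr
      exact e1.trans (by gcongr)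
    _ ≤ (‖a‖ * ‖b‖ + 1) * t * ‖v‖ := by
      have : 0 ≤ t * ‖v‖ := by positivity
      linarith

theorem zero {p : ℝ} (hp : 0 < p) : IsSchatten p (0 : H →L[ℂ] H) := by
  have hz : IsCompactOperator (0 : H →L[ℂ] H) := isCompactOperator_zero
  obtain ⟨_, b, hb⟩ := exists_eigenbasis (0 : H →L[ℂ] H) hz
  refine ⟨hz, ?_⟩
  rw [trace_abs_rpow b _ hb p hp]
  simp [Real.zero_rpow hp.ne']

end IsSchatten

end Schatten

/-- A two-sided ideal of the algebra `B(H)` of bounded operators on `H`: a linear subspace that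
absorbs multiplication by bounded operators on both sides. -/
structure OperatorIdeal (H : Type*) [NormedAddCommGroup H] [InnerProductSpace ℂ H] extends
    Submodule ℂ (H →L[ℂ] H) where
  mul_mem_left : ∀ (a : H →L[ℂ] H) {x : H →L[ℂ] H}, x ∈ carrier → a * x ∈ carrier
  mul_mem_right : ∀ (a : H →L[ℂ] H) {x : H →L[ℂ] H}, x ∈ carrier → x * a ∈ carrier

instance {H : Type*} [NormedAddCommGroup H] [InnerProductSpace ℂ H] :
    CoeSort (OperatorIdeal H) (Type _) :=
  ⟨fun I => I.toSubmodule⟩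

/-- The Schatten ideal `C_p = {x ∈ K(H) : tr (|x| ^ p) < ∞}`, for `0 < p < ∞`. -/
def schattenIdeal (H : Type*) [NormedAddCommGroup H] [InnerProductSpace ℂ H] [CompleteSpace H]
    (p : ℝ) (hp : 0 < p) : OperatorIdeal H where
  carrier := {x | Schatten.IsSchatten p x}
  zero_mem' := Schatten.IsSchatten.zero hp
  add_mem' hx hy := hx.add hp hy
  smul_mem' c x hx := by simpa using hx.mul_mul hp (c • 1) 1
  mul_mem_left a x hx := by simpa using hx.mul_mul hp a 1
  mul_mem_right a x hx := by simpa using hx.mul_mul hp 1 a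

/-- The mapping `δ`, defined on the ideal `I`, is a derivation from `I` to `J`: it takes its values
in `J`, it is linear, and `δ (x y) = δ x y + x δ y` for all `x, y ∈ I`. -/
structure IsDerivation {H : Type*} [NormedAddCommGroup H] [InnerProductSpace ℂ H]
    (I J : OperatorIdeal H) (δ : I → (H →L[ℂ] H)) : Prop where
  map_mem : ∀ x : I, δ x ∈ J.toSubmodule
  map_add : ∀ x y : I, δ (x + y) = δ x + δ y
  map_smul : ∀ (c : ℂ) (x : I), δ (c • x) = c • δ x
  leibniz : ∀ x y : I, δ ⟨(x : H →L[ℂ] H) * y, I.mul_mem_left x y.2⟩ = δ x * y + x * δ y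

/-! ### Operators that are diagonal with respect to two orthonormal families. -/

namespace Schatten

variable {H : Type*} [NormedAddCommGroup H] [InnerProductSpace ℂ H]

/-! Write v⊗e for ⟪e, ·⟫v, with e a unit vector. The Leibniz rule for x(v⊗e) = (xv)⊗e shows that a v
= δ(v⊗e)e satisfies δ(x) = ax − xa, and a is bounded by the closed graph theorem
(`exists_eq_commutator`). For p ≤ r this is all, since C_p ⊆ C_r (`IsSchatten.mono`) and C_r is an
ideal. For r < p, Hölder's inequality (`IsSchatten.mul`) makes every a in C_q induce a derivation.
What remains is the converse: if [a, C_p] ⊆ C_r, then a − l ∈ C_q for some scalar l, and subtracting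
l does not change the commutators.

The converse is tested on diagonal operators y, whose entries c come from `exists_multiplier`: if s
is not in ℓ^q, then some c in ℓ^p has cs outside ℓ^r.

Compactness modulo scalars: if the entries ⟪f, a e⟫ with e ⊥ f did not become small off
finite-dimensional subspaces, there would be orthonormal sequences with ⟪f_m, a e_n⟫ diagonal and
bounded below. With y diagonal on the e_n and Q the projection onto the span of the chosen f_n, Qy =
0, so Q[a, y] = Qay, whose singular values can be pushed out of ℓ^r
(`not_biorthogonal_of_commutator`). Small off-diagonal entries in all orthonormal directions force a
to be close to a scalar plus a compact operator (`exists_norm_sub_smul_sub_le`).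

Membership in C_q for compact a: let y carry an orthonormal family on which a⋆ decays fast to
singular vectors of a, with weights c. Then ya ∈ C_r automatically, so ay = [a, y] + ya ∈ C_r, while
its singular values are the products of c with those of a
(`isSchatten_of_commutator_of_isCompactOperator`). -/

theorem hasSum_norm_sq_of_orthonormal {J : Type*} {f : J → H} (hf : Orthonormal ℂ f) {c : J → ℂ}
    {w : H} (hw : HasSum (fun j => c j • f j) w) : HasSum (fun j => ‖c j‖ ^ 2) (‖w‖ ^ 2) := by
  classical
  have h1 : ∀ j, ⟪w, f j⟫_ℂ = starRingEnd ℂ (c j) := by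
    intro j
    have h2 := hw.mapL (innerSL ℂ (f j))
    simp only [innerSL_apply_apply, inner_smul_right, orthonormal_iff_ite.mp hf] at h2
    have h3 : ⟪f j, w⟫_ℂ = c j := by
      refine h2.unique ?_
      simpa using hasSum_single (f := fun k => c k * if j = k then 1 else 0) j
        (fun k hk => by simp [Ne.symm hk])
    rw [← inner_conj_symm, h3]
  have h2 := (hw.mapL (innerSL ℂ w)).mapL Complex.reCLM
  simp only [innerSL_apply_apply, inner_smul_right, h1, RCLike.mul_conj] at h2
  have h3 : Complex.reCLM ⟪w, w⟫_ℂ = ‖w‖ ^ 2 := by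
    simpa using inner_self_eq_norm_sq (𝕜 := ℂ) w
  rw [h3] at h2
  convert h2 using 2 with j
  norm_cast

/-- The operator `y` is `∑ j, d j • ⟪h j, ·⟫ f j`. -/
def IsDiagonal {J : Type*} (f h : J → H) (d : J → ℝ) (y : H →L[ℂ] H) : Prop :=
  ∀ v, HasSum (fun j => ((d j : ℂ) * ⟪h j, v⟫_ℂ) • f j) (y v)

theorem hasSum_norm_sq_le {J : Type*} {h : J → H} (hh : Orthonormal ℂ h) {d : J → ℝ} {C : ℝ}
    (hd : ∀ j, |d j| ≤ C) (v : H) {s : ℝ}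
    (hs : HasSum (fun j => ‖(d j : ℂ) * ⟪h j, v⟫_ℂ‖ ^ 2) s) : s ≤ C ^ 2 * ‖v‖ ^ 2 := by
  have h1 := (hh.inner_products_summable v).mul_left (C ^ 2)
  rw [← hs.tsum_eq]
  calc _ ≤ ∑' j, C ^ 2 * ‖⟪h j, v⟫_ℂ‖ ^ 2 := by
        refine hs.summable.tsum_le_tsum (fun j => ?_) h1
        rw [norm_mul, mul_pow, Complex.norm_real, Real.norm_eq_abs]
        gcongr
        exact hd j
    _ ≤ C ^ 2 * ‖v‖ ^ 2 := by
        rw [tsum_mul_left]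
        gcongr
        exact hh.tsum_inner_products_le v

namespace IsDiagonal

theorem norm_apply_le {J : Type*} {f h : J → H} {d : J → ℝ} {y : H →L[ℂ] H}
    (hy : IsDiagonal f h d y) (hf : Orthonormal ℂ f) (hh : Orthonormal ℂ h) {C : ℝ} (hC : 0 ≤ C)
    (hd : ∀ j, |d j| ≤ C) (v : H) : ‖y v‖ ≤ C * ‖v‖ := by
  refine le_of_sq_le_sq ?_ (by positivity)
  rw [mul_pow]
  exact hasSum_norm_sq_le hh hd v (hasSum_norm_sq_of_orthonormal hf (hy v))

theorem apply_self {J : Type*} {f h : J → H} {d : J → ℝ} {y : H →L[ℂ] H}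
    (hy : IsDiagonal f h d y) (hh : Orthonormal ℂ h) (j : J) : y (h j) = (d j : ℂ) • f j := by
  classical
  refine (hy (h j)).unique ?_
  convert hasSum_ite_eq j ((d j : ℂ) • f j) using 2 with k
  rw [orthonormal_iff_ite.mp hh]
  split_ifs with hk
  · simp [hk]
  · simp

theorem apply_eq_zero {J : Type*} {f h : J → H} {d : J → ℝ} {y : H →L[ℂ] H}
    (hy : IsDiagonal f h d y) (v : H) (hv : ∀ j, d j ≠ 0 → ⟪h j, v⟫_ℂ = 0) : y v = 0 := by
  refine (hy v).unique ?_
  convert hasSum_zero using 2 with k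
  by_cases hk : d k = 0
  · simp [hk]
  · simp [hv k hk]

theorem star_eq [CompleteSpace H] {J : Type*} {f h : J → H} {d : J → ℝ} {y : H →L[ℂ] H}
    (hy : IsDiagonal f h d y) {d' : J → ℝ} {y' : H →L[ℂ] H} (hy' : IsDiagonal h f d' y')
    (hd : d = d') : star y = y' := by
  subst hd
  rw [ContinuousLinearMap.star_eq_adjoint, eq_comm, ContinuousLinearMap.eq_adjoint_iff]
  intro v w
  have h1 := (hy w).mapL (innerSL ℂ v)
  have h2 := (hy' v).mapL (innerSL ℂ w)
  simp only [innerSL_apply_apply, inner_smul_right] at h1 h2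
  have h3 := h2.star
  rw [RCLike.star_def, inner_conj_symm] at h3
  refine h3.unique ?_
  convert h1 using 2 with j
  simp only [map_mul, inner_conj_symm, Complex.conj_ofReal]
  ring

/-- Dropping the finitely many entries above ε/2 leaves a diagonal operator of norm at most ε/2, so
y is a norm limit of finite-rank operators. -/
theorem isCompactOperator [CompleteSpace H] {J : Type*} {f h : J → H} {d : J → ℝ}
    {y : H →L[ℂ] H}
    (hy : IsDiagonal f h d y) (hf : Orthonormal ℂ f) (hh : Orthonormal ℂ h)
    (hd : ∀ ε > 0, {j | ε < |d j|}.Finite) : IsCompactOperator y := by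
  classical
  have hcl : IsClosed {T : H →L[ℂ] H | IsCompactOperator T} := isClosed_setOfPred_isCompactOperator
  change y ∈ {T : H →L[ℂ] H | IsCompactOperator T}
  rw [← hcl.closure_eq, Metric.mem_closure_iff]
  intro ε hε
  have hF := hd (ε / 2) (half_pos hε)
  set z : H →L[ℂ] H := ∑ j ∈ hF.toFinset, (d j : ℂ) • InnerProductSpace.rankOne ℂ (f j) (h j)
  refine ⟨z, ?_, ?_⟩
  · have : z ∈ compactOperator (RingHom.id ℂ) H H := by
      refine Submodule.sum_mem _ (fun j _ => Submodule.smul_mem _ _ ?_)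
      have h1 : InnerProductSpace.rankOne ℂ (f j) (h j) =
          (ContinuousLinearMap.toSpanSingleton ℂ (f j)).comp (innerSL ℂ (h j)) := by
        ext v; simp
      rw [h1]
      have h2 : IsCompactOperator (innerSL ℂ (h j)) :=
        isCompactOperator_of_locallyCompactSpace_dom _
      exact h2.clm_comp (ContinuousLinearMap.toSpanSingleton ℂ (f j))
    exact this
  · have hz : IsDiagonal f h (fun j => if j ∈ hF.toFinset then 0 else d j) (y - z) := by
      intro v
      have h2 : HasSum (fun j => if j ∈ hF.toFinset then ((d j : ℂ) * ⟪h j, v⟫_ℂ) • f j else 0)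
          (z v) := by
        have h3 : z v = ∑ j ∈ hF.toFinset,
            if j ∈ hF.toFinset then ((d j : ℂ) * ⟪h j, v⟫_ℂ) • f j else 0 := by
          rw [sum_apply]
          refine Finset.sum_congr rfl (fun j hj => ?_)
          rw [if_pos hj, mul_smul]
          simp
        rw [h3]
        exact hasSum_sum_of_ne_finset_zero (fun j hj => if_neg hj)
      rw [sub_apply]
      refine ((hy v).sub h2).congr_fun (fun j => ?_)
      by_cases hj : j ∈ hF.toFinset
      · simp only [if_pos hj]
        simp
      · simp only [if_neg hj, sub_zero]
    rw [dist_eq_norm]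
    refine lt_of_le_of_lt (ContinuousLinearMap.opNorm_le_bound _ (half_pos hε).le
      (hz.norm_apply_le hf hh (half_pos hε).le (fun j => ?_))) (half_lt_self hε)
    split_ifs with hj
    · simpa using (half_pos hε).le
    · simpa using hj

end IsDiagonal

theorem exists_isDiagonal [CompleteSpace H] {J : Type*} {f h : J → H} (hf : Orthonormal ℂ f)
    (hh : Orthonormal ℂ h) {d : J → ℝ} {C : ℝ} (hC : 0 ≤ C) (hd : ∀ j, |d j| ≤ C) :
    ∃ y : H →L[ℂ] H, IsDiagonal f h d y := by
  have hs : ∀ v : H, Summable (fun j => ((d j : ℂ) * ⟪h j, v⟫_ℂ) • f j) := by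
    intro v
    have := hf.orthogonalFamily.summable_iff_norm_sq_summable
      (fun j => (d j : ℂ) * ⟪h j, v⟫_ℂ)
    simp only [LinearIsometry.toSpanSingleton_apply] at this
    rw [this]
    refine ((hh.inner_products_summable v).mul_left (C ^ 2)).of_nonneg_of_le
      (fun _ => by positivity) (fun j => ?_)
    rw [norm_mul, mul_pow, Complex.norm_real, Real.norm_eq_abs]
    gcongr
    exact hd j
  let L : H →ₗ[ℂ] H :=
    { toFun := fun v => ∑' j, ((d j : ℂ) * ⟪h j, v⟫_ℂ) • f j
      map_add' := fun v w => by
        rw [← (hs v).tsum_add (hs w)]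
        congr! 2 with j
        rw [inner_add_right, mul_add, add_smul]
      map_smul' := fun c v => by
        rw [RingHom.id_apply, ← (hs v).tsum_const_smul]
        congr! 2 with j
        rw [inner_smul_right, smul_smul, mul_left_comm] }
  refine ⟨L.mkContinuous C (fun v => ?_), fun v => (hs v).hasSum⟩
  refine le_of_sq_le_sq ?_ (by positivity)
  rw [mul_pow]
  exact hasSum_norm_sq_le hh hd v (hasSum_norm_sq_of_orthonormal hf (hs v).hasSum)

/-- The trace of `|z| ^ p` for an operator `z` with given eigenvectors of `z⋆ z`. -/
theorem trace_abs_rpow_of_orthonormal [CompleteSpace H] {J : Type*} {h : J → H}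
    (hh : Orthonormal ℂ h)
    (z : H →L[ℂ] H) (hz : ∀ v, (∀ j, ⟪h j, v⟫_ℂ = 0) → z v = 0)
    (hzz : ∀ j, (star z * z) (h j) = ((‖z (h j)‖ ^ 2 : ℝ) : ℂ) • h j) (p : ℝ) (hp : 0 < p) :
    trace (CFC.abs z ^ p) = ∑' j, ENNReal.ofReal (‖z (h j)‖ ^ p) := by
  -- The added basis vectors are orthogonal to all `h j`, hence killed by `z`, and contribute
  -- nothing to the trace.
  obtain ⟨w, b, hw, hb⟩ := hh.toSubtypeRange.exists_hilbertBasis_extension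
  have hzero : ∀ i : w, (i : H) ∉ Set.range h → z (b i) = 0 := by
    intro i hi
    refine hz _ (fun j => ?_)
    have h1 : h j = b ⟨h j, hw ⟨j, rfl⟩⟩ := by rw [hb]
    rw [h1, b.orthonormal.2]
    rintro rfl
    exact hi ⟨j, rfl⟩
  rw [trace_abs_rpow b z _ p hp]
  · have hinj : Function.Injective (fun j : J => (⟨h j, hw ⟨j, rfl⟩⟩ : w)) := by
      intro i j hij
      exact hh.linearIndependent.injective (congrArg Subtype.val hij)
    rw [← hinj.tsum_eq]
    · simp [hb]
    · intro i hi
      by_contra hni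
      refine hi ?_
      simp only
      rw [hzero i, norm_zero, Real.zero_rpow hp.ne', ENNReal.ofReal_zero]
      rintro ⟨j, hj⟩
      exact hni ⟨j, Subtype.ext hj⟩
  · intro i
    by_cases hi : (i : H) ∈ Set.range h
    · obtain ⟨j, hj⟩ := hi
      have : b i = h j := by rw [hb, hj]
      rw [this]
      exact hzz j
    · rw [mul_apply_eq_comp, hzero i hi]
      simp

theorem finite_lt_abs_of_tsum_lt_top {J : Type*} {d : J → ℝ} {p : ℝ} (hp : 0 < p)
    (hs : ∑' j, ENNReal.ofReal (|d j| ^ p) < ∞) (ε : ℝ) (hε : 0 < ε) :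
    {j | ε < |d j|}.Finite := by
  have h1 := ENNReal.finite_const_le_of_tsum_ne_top (a := fun j => ENNReal.ofReal (|d j| ^ p))
    hs.ne (ε := ENNReal.ofReal (ε ^ p)) (by
      simpa using Real.rpow_pos_of_pos hε p)
  refine h1.subset (fun j hj => ?_)
  refine ENNReal.ofReal_le_ofReal ?_
  have := (show ε < |d j| from hj).le
  gcongr

/-- Since y⋆y h_j = d_j² h_j, the nonzero singular values of y are the nonzero |d_j|. -/
theorem IsDiagonal.isSchatten [CompleteSpace H] {J : Type*} {f h : J → H} {d : J → ℝ}
    {y : H →L[ℂ] H}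
    (hy : IsDiagonal f h d y) (hf : Orthonormal ℂ f) (hh : Orthonormal ℂ h) {p : ℝ} (hp : 0 < p)
    (hs : ∑' j, ENNReal.ofReal (|d j| ^ p) < ∞) : IsSchatten p y := by
  have hc := hy.isCompactOperator hf hh (finite_lt_abs_of_tsum_lt_top hp hs)
  obtain ⟨C, hC0, hC⟩ : ∃ C : ℝ, 0 ≤ C ∧ ∀ j, |d j| ≤ C := by
    refine ⟨‖y‖, norm_nonneg _, fun j => ?_⟩
    have := y.le_opNorm (h j)
    rwa [hy.apply_self hh, norm_smul, hf.1, hh.1, mul_one, mul_one, Complex.norm_real] at this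
  obtain ⟨y', hy'⟩ := exists_isDiagonal hh hf hC0 hC
  refine ⟨hc, ?_⟩
  rw [trace_abs_rpow_of_orthonormal hh y (fun v hv => hy.apply_eq_zero v (fun j _ => hv j)) _ p hp]
  · convert hs using 5 with j
    rw [hy.apply_self hh, norm_smul, hf.1, mul_one, Complex.norm_real, Real.norm_eq_abs]
  · intro j
    rw [hy.star_eq hy' rfl, mul_apply_eq_comp, hy.apply_self hh, map_smul, hy'.apply_self hf,
      norm_smul, hf.1, smul_smul]
    congr 1
    rw [mul_one, Complex.norm_real, Real.norm_eq_abs, sq_abs, sq]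
    norm_cast

theorem isSchatten_rankOne_self [CompleteSpace H] {e : H} (he : ‖e‖ = 1) {p : ℝ} (hp : 0 < p) :
    IsSchatten p (InnerProductSpace.rankOne ℂ e e) := by
  have ho : Orthonormal ℂ (fun _ : Unit => e) := ⟨fun _ => he, fun i j hij => (hij rfl).elim⟩
  have hd : IsDiagonal (fun _ : Unit => e) (fun _ => e) (fun _ => 1)
      (InnerProductSpace.rankOne ℂ e e) := by
    intro v
    simp
  refine hd.isSchatten ho ho hp ?_
  simp

theorem isSchatten_rankOne [CompleteSpace H] [Nontrivial H] (x y : H) {p : ℝ} (hp : 0 < p) :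
    IsSchatten p (InnerProductSpace.rankOne ℂ x y) := by
  obtain ⟨e, he⟩ := exists_norm_eq H zero_le_one
  have := (isSchatten_rankOne_self he hp).mul_mul hp (InnerProductSpace.rankOne ℂ x e)
    (InnerProductSpace.rankOne ℂ e y)
  convert this using 1
  ext v
  simp [inner_self_eq_norm_sq_to_K, he]

end Schatten

/-! ### Derivations are commutators; inclusion and Hölder's inequality for Schatten ideals. -/

namespace Schatten

variable {H : Type*} [NormedAddCommGroup H] [InnerProductSpace ℂ H]

theorem isDerivation_commutator {I J : OperatorIdeal H} {δ : I → (H →L[ℂ] H)} (a : H →L[ℂ] H)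
    (hδ : ∀ x : I, δ x = a * x - x * a)
    (hJ : ∀ x : I, a * (x : H →L[ℂ] H) - x * a ∈ J.toSubmodule) :
    IsDerivation I J δ where
  map_mem x := by rw [hδ]; exact hJ x
  map_add x y := by
    simp only [hδ, Submodule.coe_add, mul_add, add_mul]
    abel
  map_smul c x := by
    simp only [hδ, Submodule.coe_smul, smul_sub, mul_smul_comm, smul_mul_assoc]
  leibniz x y := by
    simp only [hδ, sub_mul, mul_sub, mul_assoc]
    abel

variable [CompleteSpace H]

/-- Weak continuity makes the graph closed, because weak and norm limits agree. -/
theorem continuous_of_forall_continuous_inner (a : H →ₗ[ℂ] H)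
    (ha : ∀ f : H, Continuous fun v => ⟪f, a v⟫_ℂ) : Continuous a := by
  refine a.continuous_of_seq_closed_graph (fun u x y hu hy => ?_)
  refine ext_inner_left ℂ (fun f => ?_)
  refine tendsto_nhds_unique (((innerSL ℂ f).continuous.tendsto y).comp hy) ?_
  exact ((ha f).tendsto x).comp hu

/-- Every derivation between Schatten ideals is spatial. -/
theorem exists_eq_commutator [Nontrivial H] {p : ℝ} (hp : 0 < p) {J : OperatorIdeal H}
    {δ : schattenIdeal H p hp → (H →L[ℂ] H)} (hδ : IsDerivation (schattenIdeal H p hp) J δ) :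
    ∃ a : H →L[ℂ] H, ∀ x : schattenIdeal H p hp, δ x = a * x - x * a := by
  obtain ⟨e, he⟩ := exists_norm_eq H zero_le_one
  let R : H → H → schattenIdeal H p hp := fun x y =>
    ⟨InnerProductSpace.rankOne ℂ x y, isSchatten_rankOne x y hp⟩
  have hee : ⟪e, e⟫_ℂ = 1 := by simp [inner_self_eq_norm_sq_to_K, he]
  -- For δ = [b, ·] this recipe returns b v − ⟪e, b e⟫v, that is, b up to a scalar.
  let a : H →ₗ[ℂ] H :=
    { toFun := fun v => δ (R v e) e
      map_add' := fun v w => by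
        have : R (v + w) e = R v e + R w e := Subtype.ext (by simp [R])
        rw [this, hδ.map_add, add_apply]
      map_smul' := fun c v => by
        have : R (c • v) e = c • R v e := Subtype.ext (by simp [R])
        rw [this, hδ.map_smul]
        rfl }
  -- The Leibniz rule for x and v⊗e, evaluated at e.
  have key : ∀ (x : schattenIdeal H p hp) (v : H),
      a ((x : H →L[ℂ] H) v) = δ x v + (x : H →L[ℂ] H) (a v) := by
    intro x v
    have h1 : (⟨(x : H →L[ℂ] H) * R v e, (schattenIdeal H p hp).mul_mem_left x (R v e).2⟩ :
        schattenIdeal H p hp) = R ((x : H →L[ℂ] H) v) e := by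
      refine Subtype.ext ?_
      ext w
      simp [R]
    have h2 := hδ.leibniz x (R v e)
    rw [h1] at h2
    have h3 := congrArg (fun T : H →L[ℂ] H => T e) h2
    simp only [add_apply, mul_apply_eq_comp] at h3
    have h4 : (R v e : H →L[ℂ] H) e = v := by
      simp only [R, InnerProductSpace.rankOne_apply, hee, one_smul]
    rw [h4] at h3
    exact h3
  -- Applying `key` to the rank-one operator e⊗f isolates ⟪f, a v⟫e as ⟪f, v⟫ a e − δ(e⊗f)v, which
  -- is continuous in v.
  have hcont : Continuous a := by
    refine continuous_of_forall_continuous_inner a (fun f => ?_)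
    have h1 : ∀ v, ⟪f, a v⟫_ℂ = ⟪e, ⟪f, v⟫_ℂ • a e - δ (R e f) v⟫_ℂ := by
      intro v
      have h2 := key (R e f) v
      have h3 : (R e f : H →L[ℂ] H) v = ⟪f, v⟫_ℂ • e := by simp [R]
      have h4 : (R e f : H →L[ℂ] H) (a v) = ⟪f, a v⟫_ℂ • e := by simp [R]
      rw [h3, h4, map_smul] at h2
      rw [h2, add_sub_cancel_left, inner_smul_right, hee, mul_one]
    simp_rw [h1]
    fun_prop
  refine ⟨⟨a, hcont⟩, fun x => ?_⟩
  ext v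
  have := key x v
  simp only [sub_apply, mul_apply_eq_comp]
  exact eq_sub_of_add_eq this.symm

theorem IsSchatten.mono {p r : ℝ} (hp : 0 < p) (hpr : p ≤ r) {x : H →L[ℂ] H}
    (hx : IsSchatten p x) : IsSchatten r x := by
  have hr := hp.trans_le hpr
  obtain ⟨_, b, hb⟩ := exists_eigenbasis x hx.1
  refine ⟨hx.1, ?_⟩
  have h1 := hx.2
  rw [trace_abs_rpow b x hb p hp] at h1
  rw [trace_abs_rpow b x hb r hr]
  refine lt_of_le_of_lt (ENNReal.tsum_le_tsum (g := fun i => ENNReal.ofReal (‖x‖ ^ (r - p)) *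
    ENNReal.ofReal (‖x (b i)‖ ^ p)) (fun i => ?_)) ?_
  · rw [← ENNReal.ofReal_mul (by positivity)]
    refine ENNReal.ofReal_le_ofReal ?_
    have hn : ‖x (b i)‖ ≤ ‖x‖ := by
      simpa [b.orthonormal.1 i] using x.le_opNorm (b i)
    calc ‖x (b i)‖ ^ r = ‖x (b i)‖ ^ (r - p) * ‖x (b i)‖ ^ p := by
          rw [← Real.rpow_add_of_nonneg (norm_nonneg _) (sub_nonneg.mpr hpr) hp.le, sub_add_cancel]
      _ ≤ _ := by
          have := sub_nonneg.mpr hpr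
          gcongr
  · rw [ENNReal.tsum_mul_left]
    exact ENNReal.mul_lt_top ENNReal.ofReal_lt_top h1

/-- Hölder's inequality for Schatten ideals, in qualitative form. -/
theorem IsSchatten.mul {p q r : ℝ} (hp : 0 < p) (hq : 0 < q) (hr : 0 < r)
    (hpqr : 1 / q = 1 / r - 1 / p) {x y : H →L[ℂ] H} (hx : IsSchatten q x) (hy : IsSchatten p y) :
    IsSchatten r (x * y) := by
  have hz : IsCompactOperator (x * y) := hy.1.clm_comp x
  obtain ⟨_, bx, hbx⟩ := exists_eigenbasis x hx.1
  obtain ⟨_, b', hb'⟩ := exists_eigenbasis y hy.1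
  obtain ⟨_, bz, hbz⟩ := exists_eigenbasis (x * y) hz
  refine ⟨hz, ?_⟩
  have h1 := hx.2
  have h2 := hy.2
  rw [trace_abs_rpow bx x hbx q hq] at h1
  rw [trace_abs_rpow b' y hb' p hp] at h2
  rw [trace_abs_rpow bz _ hbz r hr]
  have hpow : ∀ (s u : ℝ), 0 ≤ s → (s ^ (u / r)) ^ r = s ^ u := by
    intro s u hs
    rw [← Real.rpow_mul hs, div_mul_cancel₀ _ hr.ne']
  have hset : ∀ (s t u : ℝ), 0 ≤ s → 0 < t → 0 < u → t ^ (r / u) < s → t < s ^ (u / r) := by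
    intro s t u hs ht hu h
    have := Real.rpow_lt_rpow (by positivity) h (div_pos hu hr)
    rwa [← Real.rpow_mul ht.le, div_mul_div_cancel₀ hu.ne', div_self hr.ne', Real.rpow_one] at this
  -- The number of singular values of xy above t is at most the number for x above t^(r/q) plus the
  -- number for y above t^(r/p), as r/q + r/p = 1. Raising to the powers q/r and p/r turns both
  -- thresholds into t.
  refine tsum_rpow_lt_top _ (fun i => ‖x (bx i)‖ ^ (q / r)) (fun i => ‖y (b' i)‖ ^ (p / r))
    (fun _ => norm_nonneg _) (fun _ => by positivity)
    (fun _ => by positivity) r hr 1 one_pos (fun t ht => ?_)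
    (by simpa only [hpow _ _ (norm_nonneg _)])
    (by simpa only [hpow _ _ (norm_nonneg _)])
  have hcount := (count_le_count bz (x * y) hbz (1 * t) (by positivity)
    ((fun i => star y (bx i)) '' {i | t ^ (r / q) < ‖x (bx i)‖} ∪
      b' '' {i | t ^ (r / p) < ‖y (b' i)‖}) id (fun v hv => ?_)).trans
    ((Set.encard_union_le _ _).trans (add_le_add (Set.encard_image_le _ _)
      (Set.encard_image_le _ _)))
  · refine hcount.trans (add_le_add (Set.encard_le_encard ?_) (Set.encard_le_encard ?_))
    · intro i hi
      exact hset _ _ _ (norm_nonneg _) ht hq hi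
    · intro i hi
      exact hset _ _ _ (norm_nonneg _) ht hp hi
  · have e1 := norm_map_le_of_orthogonal bx x hbx (t ^ (r / q)) (by positivity) (y v)
      (fun i hi => by
        rw [← ContinuousLinearMap.adjoint_inner_left]
        exact hv _ (Or.inl ⟨i, hi, rfl⟩))
    have e2 := norm_map_le_of_orthogonal b' y hb' (t ^ (r / p)) (by positivity) v
      (fun i hi => hv _ (Or.inr ⟨i, hi, rfl⟩))
    have e3 : t ^ (r / q) * t ^ (r / p) = t := by
      rw [← Real.rpow_add ht]
      have : r / q + r / p = 1 := by
        have : r / q = r * (1 / q) := by ring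
        rw [this, hpqr]
        field_simp
        ring
      rw [this, Real.rpow_one]
    calc ‖(x * y) v‖ ≤ t ^ (r / q) * ‖y v‖ := e1
      _ ≤ t ^ (r / q) * (t ^ (r / p) * ‖v‖) := by gcongr
      _ = 1 * t * ‖v‖ := by rw [← mul_assoc, e3, one_mul]

end Schatten

/-! ### Multipliers of sequence spaces, and compact operators with commutators in C_r. -/

namespace Schatten

universe u

theorem exists_finset_disjoint_le_sum {ι : Type*} {w : ι → ℝ} (hw : ∀ i, 0 ≤ w i)
    (hs : ¬ Summable w) (G : Finset ι) (M : ℝ) :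
    ∃ F : Finset ι, Disjoint G F ∧ M ≤ ∑ i ∈ F, w i := by
  classical
  by_contra! hcon
  refine hs (summable_of_sum_le (c := ∑ i ∈ G, w i + M) hw (fun S => ?_))
  rw [← Finset.sum_inter_add_sum_sdiff S G]
  refine add_le_add ?_ (hcon _ Finset.disjoint_sdiff).le
  exact Finset.sum_le_sum_of_subset_of_nonneg Finset.inter_subset_right (fun i _ _ => hw i)

theorem exists_seq_finset_disjoint_le_sum {ι : Type*} {w : ι → ℝ} (hw : ∀ i, 0 ≤ w i)
    (hs : ¬ Summable w) :
    ∃ F : ℕ → Finset ι, (∀ m n, m < n → Disjoint (F m) (F n)) ∧ ∀ k, 2 ^ k ≤ ∑ i ∈ F k, w i := by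
  classical
  obtain ⟨F, hF1, hF2⟩ := exists_seq_of_forall_finset_exists
    (fun F : Finset ι => 1 ≤ ∑ i ∈ F, w i)
    (fun F G => Disjoint F G ∧ 2 * ∑ i ∈ F, w i ≤ ∑ i ∈ G, w i) (fun S _ => by
      -- This lower bound serves both demands: it is at least 1, and at least twice the weight of
      -- each earlier block.
      obtain ⟨G, hG1, hG2⟩ := exists_finset_disjoint_le_sum hw hs (S.biUnion id)
        (1 + 2 * ∑ F ∈ S, ∑ i ∈ F, w i)
      have hnn : ∀ F ∈ S, 0 ≤ ∑ i ∈ F, w i := fun F _ => Finset.sum_nonneg (fun i _ => hw i)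
      refine ⟨G, ?_, fun F hF => ⟨(Finset.disjoint_biUnion_left _ _ _).mp hG1 F hF, ?_⟩⟩
      · have := Finset.sum_nonneg hnn
        linarith
      · have := Finset.single_le_sum hnn hF
        linarith)
  refine ⟨F, fun m n h => (hF2 m n h).1, fun k => ?_⟩
  induction k with
  | zero => simpa using hF1 0
  | succ k ih =>
    have := (hF2 k (k + 1) k.lt_succ_self).2
    rw [pow_succ]
    linarith

/-- If `s` is not in `ℓ^q`, some `c` in `ℓ^p`, with countable support, has `c s` not in `ℓ^r`. -/
theorem exists_multiplier {ι : Type u} {s : ι → ℝ} (hs : ∀ i, 0 ≤ s i) {p q r : ℝ} (hp : 0 < p)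
    (hq : 0 < q) (hr : 0 < r) (hpqr : 1 / q = 1 / r - 1 / p)
    (hsq : ∑' i, ENNReal.ofReal (s i ^ q) = ∞) :
    ∃ (J : Type u) (_ : Countable J) (σ : J → ι) (c : J → ℝ), Function.Injective σ ∧
      (∀ j, 0 ≤ c j) ∧ ∑' j, ENNReal.ofReal (|c j| ^ p) < ∞ ∧
      ∑' j, ENNReal.ofReal ((c j * s (σ j)) ^ r) = ∞ := by
  have hrp : r < p := by
    have : 0 < 1 / q := by positivity
    rw [hpqr, sub_pos] at this
    exact lt_of_one_div_lt_one_div hp this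
  have hnn : ∀ i, 0 ≤ s i ^ q := fun i => Real.rpow_nonneg (hs i) q
  -- Disjoint finite blocks whose weights W_k for s^q are at least 2^k.
  obtain ⟨F, hFd, hF⟩ := exists_seq_finset_disjoint_le_sum hnn (fun h => h.tsum_ofReal_ne_top hsq)
  set W : ℕ → ℝ := fun k => ∑ i ∈ F k, s i ^ q
  have hW : ∀ k, 0 < W k := fun k => lt_of_lt_of_le (by positivity) (hF k)
  have hsum : ∀ g : (Σ k, F k) → ℝ≥0∞, ∀ u : ℕ → ℝ, (∀ k, 0 ≤ u k) →
      (∀ j, g j = ENNReal.ofReal (u j.1 * s j.2 ^ q)) →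
      ∑' j, g j = ∑' k, ENNReal.ofReal (u k * W k) := by
    intro g u hu hg
    rw [ENNReal.tsum_sigma']
    congr! 2 with k
    rw [tsum_fintype, Finset.mul_sum, ENNReal.ofReal_sum_of_nonneg
      (fun i _ => mul_nonneg (hu k) (hnn i)),
      ← Finset.sum_coe_sort (F k) (fun i => ENNReal.ofReal (u k * s i ^ q))]
    exact Finset.sum_congr rfl (fun i _ => hg ⟨k, i⟩)
  -- On block k the powers c^p add up to W_k^(1 − p/r), which is geometrically small as r < p, while
  -- the powers (cs)^r add up to exactly 1, as (q/p + 1)r = q.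
  refine ⟨Σ k, F k, inferInstance, fun j => j.2, fun j => W j.1 ^ (-(1 / r)) * s j.2 ^ (q / p),
    ?_, ?_, ?_, ?_⟩
  · rintro ⟨k, i, hi⟩ ⟨l, j, hj⟩ hij
    obtain rfl : i = j := hij
    obtain rfl : k = l := by
      rcases lt_trichotomy k l with h | h | h
      · exact (Finset.disjoint_left.mp (hFd _ _ h) hi hj).elim
      · exact h
      · exact (Finset.disjoint_left.mp (hFd _ _ h) hj hi).elim
    rfl
  · exact fun j => mul_nonneg (Real.rpow_nonneg (hW _).le _) (Real.rpow_nonneg (hs _) _)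
  · rw [hsum _ (fun k => W k ^ (-(p / r))) (fun k => Real.rpow_nonneg (hW k).le _)]
    · have hρ : (2 : ℝ) ^ (1 - p / r) < 1 :=
        Real.rpow_lt_one_of_one_lt_of_neg one_lt_two (by rw [sub_neg, one_lt_div hr]; exact hrp)
      have hgeo := summable_geometric_of_lt_one (by positivity) hρ
      refine lt_of_le_of_lt (ENNReal.tsum_le_tsum (fun k => ENNReal.ofReal_le_ofReal ?_))
        (lt_top_iff_ne_top.mpr hgeo.tsum_ofReal_ne_top)
      calc W k ^ (-(p / r)) * W k = W k ^ (1 - p / r) := by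
            rw [sub_eq_neg_add, Real.rpow_add_one (hW k).ne']
        _ ≤ (2 ^ k) ^ (1 - p / r) :=
            Real.rpow_le_rpow_of_nonpos (by positivity) (hF k) (by
              rw [sub_nonpos, one_le_div hr]; exact hrp.le)
        _ = (2 ^ (1 - p / r)) ^ k := by
            rw [← Real.rpow_natCast, ← Real.rpow_natCast, ← Real.rpow_mul two_pos.le,
              ← Real.rpow_mul two_pos.le, mul_comm]
    · intro j
      rw [abs_of_nonneg (mul_nonneg (Real.rpow_nonneg (hW _).le _) (Real.rpow_nonneg (hs _) _)),
        Real.mul_rpow (Real.rpow_nonneg (hW _).le _) (Real.rpow_nonneg (hs _) _),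
        ← Real.rpow_mul (hW _).le, ← Real.rpow_mul (hs _), div_mul_cancel₀ _ hp.ne']
      congr 3
      ring
  · rw [hsum _ (fun k => (W k)⁻¹) (fun k => inv_nonneg.mpr (hW k).le)]
    · simp_rw [inv_mul_cancel₀ (hW _).ne', ENNReal.ofReal_one]
      exact ENNReal.tsum_const_eq_top_of_ne_zero one_ne_zero
    · intro j
      have h1 : s j.2 ^ (q / p) * s j.2 = s j.2 ^ (q / p + 1) := by
        rw [Real.rpow_add_of_nonneg (hs _) (by positivity) zero_le_one, Real.rpow_one]
      have h2 : (q / p + 1) * r = q := by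
        field_simp at hpqr ⊢
        linarith
      rw [mul_assoc, h1, Real.mul_rpow (Real.rpow_nonneg (hW _).le _) (Real.rpow_nonneg (hs _) _),
        ← Real.rpow_mul (hW _).le, ← Real.rpow_mul (hs _), h2, neg_mul, one_div_mul_cancel hr.ne',
        Real.rpow_neg_one]

variable {H : Type*} [NormedAddCommGroup H] [InnerProductSpace ℂ H] [CompleteSpace H]

theorem exists_orthonormal_seq (hH : ¬ FiniteDimensional ℂ H) :
    ∃ e : ℕ → H, Orthonormal ℂ e := by
  obtain ⟨w, b, hb⟩ := exists_hilbertBasis ℂ H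
  rcases finite_or_infinite w with hw | hw
  · have := Fintype.ofFinite w
    exact (hH b.toOrthonormalBasis.toBasis.finiteDimensional_of_finite).elim
  · exact ⟨_, b.orthonormal.comp _ (Infinite.natEmbedding w).injective⟩

/-- An orthonormal sequence is weakly null by Bessel's inequality, so 0 is the only possible norm
limit of a subsequence of its image. -/
theorem tendsto_apply_of_isCompactOperator {a : H →L[ℂ] H} (ha : IsCompactOperator a)
    {e : ℕ → H} (he : Orthonormal ℂ e) :
    Filter.Tendsto (fun n => a (e n)) Filter.atTop (nhds 0) := by
  have hweak : ∀ u : H, Filter.Tendsto (fun n => ⟪u, e n⟫_ℂ) Filter.atTop (nhds 0) := by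
    intro u
    have h1 := (he.inner_products_summable u).tendsto_atTop_zero
    rw [tendsto_zero_iff_norm_tendsto_zero]
    have h2 := h1.sqrt
    simpa [norm_inner_symm] using h2
  refine Filter.tendsto_of_subseq_tendsto (fun ns hns => ?_)
  have hK : IsCompact (closure (a '' Metric.closedBall 0 1)) :=
    IsCompactOperator.isCompact_closure_image_closedBall (𝕜₁ := ℂ) (𝕜₂ := ℂ) (σ₁₂ := RingHom.id ℂ)
      (f := (a : H →ₗ[ℂ] H)) ha 1
  obtain ⟨w, -, φ, hφ, hw⟩ := hK.tendsto_subseq (x := fun n => a (e (ns n))) (fun n =>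
    subset_closure ⟨e (ns n), by simp [he.1], rfl⟩)
  have hw0 : w = 0 := by
    refine ext_inner_left ℂ (fun u => ?_)
    rw [inner_zero_right]
    refine tendsto_nhds_unique (((innerSL ℂ u).continuous.tendsto w).comp hw) ?_
    have h1 := (hweak (star a u)).comp (hns.comp hφ.tendsto_atTop)
    refine h1.congr (fun n => ?_)
    simp only [Function.comp_apply, innerSL_apply_apply]
    rw [ContinuousLinearMap.star_eq_adjoint, ContinuousLinearMap.adjoint_inner_left]
  rw [hw0] at hw
  exact ⟨φ, hw⟩

/-- Since ‖a⋆e‖² = ⟪e, aa⋆e⟫ ≤ ‖aa⋆e‖ for unit e, compactness of aa⋆ suffices, and that is immediate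
from compactness of a. -/
theorem tendsto_star_apply_of_isCompactOperator {a : H →L[ℂ] H} (ha : IsCompactOperator a)
    {e : ℕ → H} (he : Orthonormal ℂ e) :
    Filter.Tendsto (fun n => ‖star a (e n)‖) Filter.atTop (nhds 0) := by
  have hc : IsCompactOperator (a * star a) := ha.comp_clm (star a)
  have h1 := (tendsto_apply_of_isCompactOperator hc he).norm.sqrt
  rw [norm_zero, Real.sqrt_zero] at h1
  refine squeeze_zero (fun _ => norm_nonneg _) (fun n => Real.le_sqrt_of_sq_le ?_) h1
  calc ‖star a (e n)‖ ^ 2 = RCLike.re ⟪star a (e n), star a (e n)⟫_ℂ :=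
        (inner_self_eq_norm_sq (𝕜 := ℂ) _).symm
    _ = RCLike.re ⟪e n, (a * star a) (e n)⟫_ℂ := by
        conv_lhs => rw [ContinuousLinearMap.star_eq_adjoint, ContinuousLinearMap.adjoint_inner_left]
        rfl
    _ ≤ ‖e n‖ * ‖(a * star a) (e n)‖ := re_inner_le_norm _ _
    _ = ‖(a * star a) (e n)‖ := by rw [he.1, one_mul]

/-- A diagonal operator times an operator whose adjoint is rapidly decreasing on the right
orthonormal family belongs to the Schatten ideal. -/
theorem IsDiagonal.isSchatten_mul_of_le {J : Type*} {f h : J → H} {d θ : J → ℝ}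
    {y a : H →L[ℂ] H} (hy : IsDiagonal f h d y) (hf : Orthonormal ℂ f) {C : ℝ} (hC : 0 ≤ C)
    (hd : ∀ j, |d j| ≤ C) (hya : IsCompactOperator (y * a)) (hθ : ∀ j, 0 ≤ θ j)
    (ha : ∀ j, ‖star a (h j)‖ ≤ θ j ^ 2) (hθ2 : Summable fun j => θ j ^ 2) {r : ℝ} (hr : 0 < r)
    (hθr : ∑' j, ENNReal.ofReal (θ j ^ r) < ∞) : IsSchatten r (y * a) := by
  obtain ⟨_, b, hb⟩ := exists_eigenbasis (y * a) hya
  refine ⟨hya, ?_⟩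
  rw [trace_abs_rpow b _ hb r hr]
  -- The summand 1 only keeps `K` positive.
  set K : ℝ := C * √(∑' j, θ j ^ 2) + 1
  have hK : 0 < K := by positivity
  refine tsum_rpow_lt_top _ θ θ (fun _ => norm_nonneg _) hθ hθ r hr K hK (fun t ht => ?_) hθr hθr
  refine (count_le_count b (y * a) hb (K * t) (by positivity) {j | t < θ j}
    (fun j => star a (h j)) (fun v hv => ?_)).trans le_self_add
  have hinner : ∀ j, ⟪h j, a v⟫_ℂ = ⟪star a (h j), v⟫_ℂ := fun j => by
    rw [ContinuousLinearMap.star_eq_adjoint, ContinuousLinearMap.adjoint_inner_left]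
  have hle : ‖(y * a) v‖ ≤ C * √(∑' j, θ j ^ 2) * t * ‖v‖ := by
    refine le_of_sq_le_sq ?_ (by positivity)
    have e1 : (C * √(∑' j, θ j ^ 2) * t * ‖v‖) ^ 2 = (C * t * ‖v‖) ^ 2 * ∑' j, θ j ^ 2 := by
      rw [← Real.sq_sqrt (tsum_nonneg fun j => sq_nonneg (θ j))]
      simp only [Real.sqrt_sq (Real.sqrt_nonneg _)]
      ring
    rw [e1]
    -- Coefficients with θ_j > t vanish. For the others θ_j² ≤ tθ_j: one factor yields the threshold
    -- t, the other stays square summable. This is why the decay is required of order θ².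
    refine hasSum_le (fun j => ?_) (hasSum_norm_sq_of_orthonormal hf (hy (a v)))
      (hθ2.hasSum.mul_left _)
    rw [← mul_pow, hinner]
    refine pow_le_pow_left₀ (norm_nonneg _) ?_ 2
    by_cases hj : t < θ j
    · rw [hv j hj, mul_zero, norm_zero]
      have := hθ j
      positivity
    · rw [norm_mul, Complex.norm_real, Real.norm_eq_abs]
      calc |d j| * ‖⟪star a (h j), v⟫_ℂ‖ ≤ C * (θ j ^ 2 * ‖v‖) := by
            refine mul_le_mul (hd j) ?_ (norm_nonneg _) hC
            refine (norm_inner_le_norm _ _).trans ?_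
            gcongr
            exact ha j
        _ = C * (θ j * θ j * ‖v‖) := by ring
        _ ≤ C * (t * θ j * ‖v‖) := by
            have := hθ j
            have := not_lt.mp hj
            gcongr
        _ = C * t * ‖v‖ * θ j := by ring
  refine hle.trans ?_
  have : 0 ≤ t * ‖v‖ := by positivity
  simp only [K]
  linarith

theorem abs_le_of_tsum_lt_top {J : Type*} {d : J → ℝ} {p : ℝ} (hp : 0 < p)
    (hs : ∑' j, ENNReal.ofReal (|d j| ^ p) < ∞) : ∃ C : ℝ, 0 ≤ C ∧ ∀ j, |d j| ≤ C := by
  have hfin := finite_lt_abs_of_tsum_lt_top hp hs 1 one_pos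
  refine ⟨1 + ∑ j ∈ hfin.toFinset, |d j|, by positivity, fun j => ?_⟩
  by_cases hj : 1 < |d j|
  · have := Finset.single_le_sum (f := fun j => |d j|) (fun i _ => abs_nonneg _)
      (hfin.mem_toFinset.mpr hj)
    linarith
  · have : 0 ≤ ∑ j ∈ hfin.toFinset, |d j| := by positivity
    linarith

theorem isSchatten_of_commutator_of_isCompactOperator (hH : ¬ FiniteDimensional ℂ H)
    {p q r : ℝ} (hp : 0 < p) (hq : 0 < q) (hr : 0 < r) (hpqr : 1 / q = 1 / r - 1 / p)
    {a : H →L[ℂ] H} (ha : IsCompactOperator a)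
    (hcomm : ∀ x, IsSchatten p x → IsSchatten r (a * x - x * a)) : IsSchatten q a := by
  obtain ⟨_, b, hb⟩ := exists_eigenbasis a ha
  refine ⟨ha, ?_⟩
  rw [trace_abs_rpow b a hb q hq, lt_top_iff_ne_top]
  intro htop
  obtain ⟨J, hJ, σ, c, hσ, hc0, hcp, hcr⟩ :=
    exists_multiplier (fun i => norm_nonneg (a (b i))) hp hq hr hpqr htop
  have := Encodable.ofCountable J
  obtain ⟨e, he⟩ := exists_orthonormal_seq hH
  -- A subsequence along which a⋆ decays like the square of 2^(−n), so that θ_j = 2^(−n), with n the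
  -- code of j, is admissible in `IsDiagonal.isSchatten_mul_of_le`.
  obtain ⟨φ, hφ, hφe⟩ := Filter.extraction_forall_of_eventually
    (P := fun n k => ‖star a (e k)‖ ≤ ((1 / 2 : ℝ) ^ n) ^ 2) (fun n =>
      ((tendsto_star_apply_of_isCompactOperator ha he).eventually_lt_const (by positivity)).mono
        fun _ h => h.le)
  set g : J → H := fun j => e (φ (Encodable.encode j))
  have hg : Orthonormal ℂ g := he.comp _ (hφ.injective.comp Encodable.encode_injective)
  have hf : Orthonormal ℂ (fun j => b (σ j)) := b.orthonormal.comp _ hσ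
  obtain ⟨C, hC0, hC⟩ := abs_le_of_tsum_lt_top hp hcp
  obtain ⟨y, hy⟩ := exists_isDiagonal hf hg hC0 hC
  obtain ⟨y', hy'⟩ := exists_isDiagonal hg hf hC0 hC
  have hyp := hy.isSchatten hf hg hp hcp
  have hgeo : ∀ u : ℝ, 0 < u → Summable fun j : J => ((1 / 2 : ℝ) ^ Encodable.encode j) ^ u := by
    intro u hu
    have h1 : Summable fun n : ℕ => ((1 / 2 : ℝ) ^ u) ^ n :=
      summable_geometric_of_lt_one (by positivity)
        (Real.rpow_lt_one (by norm_num) (by norm_num) hu)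
    refine (h1.comp_injective (Encodable.encode_injective (α := J))).congr (fun j => ?_)
    simp only [Function.comp_apply]
    rw [← Real.rpow_natCast, ← Real.rpow_natCast, ← Real.rpow_mul (by norm_num),
      ← Real.rpow_mul (by norm_num), mul_comm]
  have hya : IsSchatten r (y * a) := by
    refine hy.isSchatten_mul_of_le (θ := fun j => (1 / 2 : ℝ) ^ Encodable.encode j) hf hC0 hC
      (hyp.1.comp_clm a) (fun j => by positivity) (fun j => hφe _) ?_ hr
      (lt_top_iff_ne_top.mpr (hgeo r hr).tsum_ofReal_ne_top)
    simpa using hgeo 2 two_pos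
  -- ay = [a, y] + ya.
  have hay : IsSchatten r (a * y) := by
    simpa using (hcomm y hyp).add hr hya
  have hayg : ∀ j, (a * y) (g j) = (c j : ℂ) • a (b (σ j)) := by
    intro j
    rw [mul_apply_eq_comp, hy.apply_self hg, map_smul]
  have hnorm : ∀ j, ‖(a * y) (g j)‖ = c j * ‖a (b (σ j))‖ := by
    intro j
    rw [hayg, norm_smul, Complex.norm_real, Real.norm_of_nonneg (hc0 j)]
  have htr := hay.2
  rw [trace_abs_rpow_of_orthonormal hg (a * y) _ _ r hr] at htr
  · simp_rw [hnorm, hcr] at htr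
    exact lt_irrefl _ htr
  · intro v hv
    rw [mul_apply_eq_comp, hy.apply_eq_zero v (fun j _ => hv j), map_zero]
  · intro j
    rw [hnorm, mul_apply_eq_comp, hayg, star_mul, hy.star_eq hy' rfl, mul_apply_eq_comp, map_smul,
      ← mul_apply_eq_comp (star a), hb, smul_smul, map_smul, hy'.apply_self hf, smul_smul]
    congr 1
    push_cast
    ring

end Schatten

/-! ### Compactness modulo scalars. -/

namespace Schatten

variable {H : Type*} [NormedAddCommGroup H] [InnerProductSpace ℂ H]

theorem IsDiagonal.apply_of_forall_ne {J : Type*} {f h : J → H} {d : J → ℝ} {y : H →L[ℂ] H}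
    (hy : IsDiagonal f h d y) {v : H} (j : J) (hv : ∀ k, k ≠ j → ⟪h k, v⟫_ℂ = 0) :
    y v = ((d j : ℂ) * ⟪h j, v⟫_ℂ) • f j := by
  refine (hy v).unique ?_
  exact hasSum_single j (fun k hk => by simp [hv k hk])

theorem isCompactOperator_starProjection (M : Submodule ℂ H) [FiniteDimensional ℂ M] :
    IsCompactOperator M.starProjection := by
  have h2 : IsCompactOperator M.orthogonalProjectionOnto :=
    isCompactOperator_of_locallyCompactSpace_dom _
  exact h2.clm_comp M.subtypeL

/-- Difference of diagonal entries by polarisation. For orthogonal unit vectors, u + v and u − v are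
again orthogonal, so all three bounds are off-diagonal estimates. The constant is 1 + 1 + 2·2. -/
theorem norm_inner_sub_inner_le {a : H →L[ℂ] H} {ε : ℝ} {u v : H} (hu : ‖u‖ = 1) (hv : ‖v‖ = 1)
    (hε : 0 ≤ ε) (h1 : ‖⟪u, a v⟫_ℂ‖ ≤ ε) (h2 : ‖⟪v, a u⟫_ℂ‖ ≤ ε)
    (h3 : ‖⟪u - v, a (u + v)⟫_ℂ‖ ≤ ε * ‖u + v‖ * ‖u - v‖) :
    ‖⟪v, a v⟫_ℂ - ⟪u, a u⟫_ℂ‖ ≤ 6 * ε := by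
  have e1 : ⟪v, a v⟫_ℂ - ⟪u, a u⟫_ℂ =
      ⟪u, a v⟫_ℂ - ⟪v, a u⟫_ℂ - ⟪u - v, a (u + v)⟫_ℂ := by
    simp only [map_add, inner_sub_left, inner_add_right]
    ring
  have e2 : ‖u + v‖ ≤ 2 := (norm_add_le _ _).trans (by linarith)
  have e3 : ‖u - v‖ ≤ 2 := (norm_sub_le _ _).trans (by linarith)
  have e4 : ε * ‖u + v‖ * ‖u - v‖ ≤ ε * 2 * 2 := by gcongr
  rw [e1]
  calc _ ≤ ‖⟪u, a v⟫_ℂ‖ + ‖⟪v, a u⟫_ℂ‖ + ‖⟪u - v, a (u + v)⟫_ℂ‖ :=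
        (norm_sub_le _ _).trans (add_le_add (norm_sub_le _ _) le_rfl)
    _ ≤ 6 * ε := by linarith

/-- Let l be the diagonal entry at a unit vector u ⊥ S, and P the projection onto M = span(S ∪ {u}).
On Mᗮ all diagonal entries are within 6ε of l, and off-diagonal ones are at most ε, so the
compression of a − l to Mᗮ has norm at most 7ε. The rest of a − l is compact because M is
finite-dimensional. -/
theorem exists_norm_sub_smul_sub_le (hH : ¬ FiniteDimensional ℂ H) {a : H →L[ℂ] H} {ε : ℝ}
    (hε : 0 < ε) {S : Finset H} (hS : ∀ e f : H, (∀ u ∈ S, ⟪u, e⟫_ℂ = 0) →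
      (∀ u ∈ S, ⟪u, f⟫_ℂ = 0) → ⟪f, e⟫_ℂ = 0 → ‖⟪f, a e⟫_ℂ‖ ≤ ε * ‖e‖ * ‖f‖) :
    ∃ (l : ℂ) (k : H →L[ℂ] H), ‖l‖ ≤ ‖a‖ ∧ IsCompactOperator k ∧ ‖a - l • 1 - k‖ ≤ 7 * ε := by
  classical
  obtain ⟨u, hu1, huS⟩ : ∃ u : H, ‖u‖ = 1 ∧ ∀ w ∈ S, ⟪w, u⟫_ℂ = 0 := by
    have hne : (Submodule.span ℂ (S : Set H))ᗮ ≠ ⊥ := by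
      intro h
      rw [Submodule.orthogonal_eq_bot_iff] at h
      exact hH (Module.finite_def.mpr ⟨S, h⟩)
    obtain ⟨v, hv, hv0⟩ := Submodule.exists_mem_ne_zero_of_ne_bot hne
    refine ⟨((‖v‖⁻¹ : ℝ) : ℂ) • v, by simp [norm_smul, hv0], fun w hw => ?_⟩
    rw [inner_smul_right, hv w (Submodule.subset_span hw), mul_zero]
  set M : Submodule ℂ H := Submodule.span ℂ (insert u S : Finset H)
  have hMu : ∀ v ∈ Mᗮ, ⟪u, v⟫_ℂ = 0 := fun v hv => hv u (Submodule.subset_span (by simp))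
  have hMS : ∀ v ∈ Mᗮ, ∀ w ∈ S, ⟪w, v⟫_ℂ = 0 := fun v hv w hw =>
    hv w (Submodule.subset_span (by simp [hw]))
  set l : ℂ := ⟪u, a u⟫_ℂ
  set b : H →L[ℂ] H := a - l • 1
  set P : H →L[ℂ] H := M.starProjection
  have hP : IsCompactOperator P := isCompactOperator_starProjection M
  have hPm : ∀ v, v - P v ∈ Mᗮ := fun v => M.sub_starProjection_mem_orthogonal v
  have hPinner : ∀ x ∈ Mᗮ, ∀ v, ⟪x, v - P v⟫_ℂ = ⟪x, v⟫_ℂ := by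
    intro x hx v
    rw [inner_sub_right, inner_eq_zero_symm.mp (hx (P v) (M.starProjection_apply_mem v)), sub_zero]
  have hdiag : ∀ v ∈ Mᗮ, ‖v‖ = 1 → ‖⟪v, a v⟫_ℂ - l‖ ≤ 6 * ε := by
    intro v hv hv1
    have huv := hMu v hv
    have hvu := inner_eq_zero_symm.mp huv
    refine norm_inner_sub_inner_le hu1 hv1 hε.le ?_ ?_ ?_
    · simpa [hu1, hv1] using hS v u (hMS v hv) huS huv
    · simpa [hu1, hv1] using hS u v huS (hMS v hv) hvu
    · refine hS _ _ (fun w hw => ?_) (fun w hw => ?_) ?_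
      · rw [inner_add_right, huS w hw, hMS v hv w hw, add_zero]
      · rw [inner_sub_right, huS w hw, hMS v hv w hw, sub_zero]
      · simp [huv, hvu, inner_self_eq_norm_sq_to_K, hu1, hv1]
  have hunit : ∀ v ∈ Mᗮ, ‖v‖ = 1 → ‖b v - P (b v)‖ ≤ 7 * ε := by
    intro v hv hv1
    set z := b v - P (b v)
    have hz : z ∈ Mᗮ := hPm _
    have hvv : ⟪v, v⟫_ℂ = 1 := by simp [inner_self_eq_norm_sq_to_K, hv1]
    have hvz : ⟪v, z⟫_ℂ = ⟪v, a v⟫_ℂ - l := by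
      rw [hPinner v hv]
      simp only [b, sub_apply, smul_apply, one_apply_eq_self, inner_sub_right,
        inner_smul_right, hvv, mul_one]
    -- The part of z orthogonal to v: ‖x‖² = ⟪x, a v⟫ ≤ ε‖x‖, while the part along v is controlled
    -- by `hdiag`.
    set x := z - ⟪v, z⟫_ℂ • v
    have hx : x ∈ Mᗮ := Submodule.sub_mem _ hz (Submodule.smul_mem _ _ hv)
    have hvx : ⟪v, x⟫_ℂ = 0 := by
      rw [inner_sub_right, inner_smul_right, hvv, mul_one, sub_self]
    have hxv := inner_eq_zero_symm.mp hvx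
    have hxx : ⟪x, x⟫_ℂ = ⟪x, a v⟫_ℂ := by
      have h1 : ⟪x, x⟫_ℂ = ⟪x, z⟫_ℂ := by
        conv_lhs => rw [show x = z - ⟪v, z⟫_ℂ • v from rfl]
        rw [inner_sub_right, inner_smul_right]
        change ⟪x, z⟫_ℂ - _ * ⟪x, v⟫_ℂ = _
        rw [hxv, mul_zero, sub_zero]
      rw [h1, hPinner x hx]
      simp [b, hxv]
    have hxε : ‖x‖ ≤ ε := by
      have h1 := hS v x (hMS v hv) (hMS x hx) hxv
      rw [← hxx, inner_self_eq_norm_sq_to_K, hv1, mul_one] at h1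
      simp only [norm_pow, RCLike.norm_ofReal, abs_norm] at h1
      by_contra! h
      nlinarith
    calc ‖z‖ = ‖x + ⟪v, z⟫_ℂ • v‖ := by rw [sub_add_cancel]
      _ ≤ ‖x‖ + ‖⟪v, z⟫_ℂ • v‖ := norm_add_le _ _
      _ ≤ ε + 6 * ε := by
          rw [norm_smul, hv1, mul_one, hvz]
          exact add_le_add hxε (hdiag v hv hv1)
      _ = 7 * ε := by ring
  have hall : ∀ v ∈ Mᗮ, ‖b v - P (b v)‖ ≤ 7 * ε * ‖v‖ := by
    intro v hv
    rcases eq_or_ne v 0 with rfl | hv0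
    · simp
    · have hpos := norm_pos_iff.mpr hv0
      have h1 := hunit (((‖v‖⁻¹ : ℝ) : ℂ) • v) (Submodule.smul_mem _ _ hv)
        (by simp [norm_smul, hv0])
      rw [map_smul, map_smul, ← smul_sub, norm_smul, Complex.norm_real, norm_inv, norm_norm,
        inv_mul_eq_div, div_le_iff₀ hpos] at h1
      exact h1
  refine ⟨l, P * b + (1 - P) * b * P, ?_, ?_, ?_⟩
  · calc ‖l‖ ≤ ‖u‖ * ‖a u‖ := norm_inner_le_norm _ _
      _ ≤ ‖u‖ * (‖a‖ * ‖u‖) := by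
          gcongr
          exact a.le_opNorm u
      _ = ‖a‖ := by rw [hu1]; ring
  · have h1 : IsCompactOperator (P * b : H →L[ℂ] H) := hP.comp_clm b
    have hmul : ∀ T : H →L[ℂ] H, IsCompactOperator (T * P) := fun T => hP.clm_comp T
    exact h1.add (hmul ((1 - P) * b))
  · refine ContinuousLinearMap.opNorm_le_bound _ (by positivity) (fun w => ?_)
    have e1 : b - (P * b + (1 - P) * b * P) = (1 - P) * b * (1 - P) := by noncomm_ring
    have e2 : (b - (P * b + (1 - P) * b * P)) w = b (w - P w) - P (b (w - P w)) := by
      rw [e1]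
      simp
    rw [e2]
    refine (hall _ (hPm w)).trans ?_
    gcongr
    refine le_of_sq_le_sq ?_ (norm_nonneg _)
    have h1 := M.norm_sq_eq_add_norm_sq_starProjection w
    have h2 : Mᗮ.starProjection w = w - P w := by
      rw [Submodule.starProjection_orthogonal_val]
    rw [h2] at h1
    have : 0 ≤ ‖M.starProjection w‖ ^ 2 := sq_nonneg _
    linarith

variable [CompleteSpace H]

theorem not_biorthogonal_of_commutator {p q r : ℝ} (hp : 0 < p) (hq : 0 < q) (hr : 0 < r)
    (hpqr : 1 / q = 1 / r - 1 / p) {a : H →L[ℂ] H}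
    (hcomm : ∀ x, IsSchatten p x → IsSchatten r (a * x - x * a)) {e f : ℕ → H}
    (he : Orthonormal ℂ e) (hf : Orthonormal ℂ f) (hef : ∀ m n, ⟪f m, e n⟫_ℂ = 0)
    (ha : ∀ m n, m ≠ n → ⟪f m, a (e n)⟫_ℂ = 0) {ε : ℝ} (hε : 0 < ε)
    (hle : ∀ n, ε ≤ ‖⟪f n, a (e n)⟫_ℂ‖) : False := by
  have htop : ∑' n, ENNReal.ofReal (‖⟪f n, a (e n)⟫_ℂ‖ ^ q) = ∞ := by
    have h1 : ∑' _ : ℕ, ENNReal.ofReal (ε ^ q) = ∞ :=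
      ENNReal.tsum_const_eq_top_of_ne_zero (by simpa using Real.rpow_pos_of_pos hε q)
    rw [eq_top_iff, ← h1]
    refine ENNReal.tsum_le_tsum (fun n => ENNReal.ofReal_le_ofReal ?_)
    have := hle n
    gcongr
  obtain ⟨J, -, σ, c, hσ, hc0, hcp, hcr⟩ :=
    exists_multiplier (fun n => norm_nonneg ⟪f n, a (e n)⟫_ℂ) hp hq hr hpqr htop
  have heσ : Orthonormal ℂ (fun j => e (σ j)) := he.comp _ hσ
  have hfσ : Orthonormal ℂ (fun j => f (σ j)) := hf.comp _ hσ
  obtain ⟨C, hC0, hC⟩ := abs_le_of_tsum_lt_top hp hcp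
  obtain ⟨y, hy⟩ := exists_isDiagonal heσ heσ hC0 hC
  -- Q is the orthogonal projection onto the closed span of the f_σ(j). It kills y, so only Qay
  -- survives of Q[a, y].
  obtain ⟨Q, hQ⟩ := exists_isDiagonal hfσ hfσ (d := fun _ => 1) zero_le_one (by simp)
  have hQy : Q * y = 0 := by
    ext v
    rw [mul_apply_eq_comp]
    refine hQ.apply_eq_zero _ (fun j _ => ?_)
    have h1 := (hy v).mapL (innerSL ℂ (f (σ j)))
    simp only [innerSL_apply_apply, inner_smul_right, hef, mul_zero] at h1
    exact h1.unique hasSum_zero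
  have hz : IsSchatten r (Q * a * y) := by
    have h1 := (hcomm y (hy.isSchatten heσ heσ hp hcp)).mul_mul hr Q 1
    rwa [mul_one, mul_sub, ← mul_assoc, ← mul_assoc, hQy, zero_mul, sub_zero] at h1
  have hze : ∀ j, (Q * a * y) (e (σ j)) =
      ((c j : ℂ) * ⟪f (σ j), a (e (σ j))⟫_ℂ) • f (σ j) := by
    intro j
    rw [mul_apply_eq_comp, mul_apply_eq_comp, hy.apply_self heσ, map_smul, map_smul,
      hQ.apply_of_forall_ne j (fun k hk => ha _ _ (fun h => hk (hσ h))), smul_smul]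
    simp
  have hnorm : ∀ j, ‖(Q * a * y) (e (σ j))‖ = c j * ‖⟪f (σ j), a (e (σ j))⟫_ℂ‖ := by
    intro j
    rw [hze, norm_smul, norm_mul, Complex.norm_real, Real.norm_of_nonneg (hc0 j), hf.1, mul_one]
  have hinner : ∀ j k, ⟪e (σ k), star a (f (σ j))⟫_ℂ =
      starRingEnd ℂ ⟪f (σ j), a (e (σ k))⟫_ℂ := by
    intro j k
    rw [ContinuousLinearMap.star_eq_adjoint, ContinuousLinearMap.adjoint_inner_right,
      inner_conj_symm]
  have htr := hz.2
  rw [trace_abs_rpow_of_orthonormal heσ _ _ _ r hr] at htr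
  · simp_rw [hnorm, hcr] at htr
    exact lt_irrefl _ htr
  · intro v hv
    rw [mul_apply_eq_comp, hy.apply_eq_zero v (fun j _ => hv j), map_zero]
  · intro j
    rw [hnorm, mul_apply_eq_comp, hze, map_smul, star_mul, star_mul, hy.star_eq hy rfl,
      hQ.star_eq hQ rfl, mul_apply_eq_comp, mul_apply_eq_comp, hQ.apply_self hfσ]
    simp only [Complex.ofReal_one, one_smul]
    rw [hy.apply_of_forall_ne j (fun k hk => by
      rw [hinner, ha _ _ (fun h => hk (hσ h).symm), map_zero]), hinner, smul_smul]
    congr 1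
    rw [mul_mul_mul_comm, Complex.mul_conj']
    push_cast
    ring

theorem exists_finset_forall_norm_inner_le {p q r : ℝ} (hp : 0 < p) (hq : 0 < q) (hr : 0 < r)
    (hpqr : 1 / q = 1 / r - 1 / p) {a : H →L[ℂ] H}
    (hcomm : ∀ x, IsSchatten p x → IsSchatten r (a * x - x * a)) {ε : ℝ} (hε : 0 < ε) :
    ∃ S : Finset H, ∀ e f : H, (∀ u ∈ S, ⟪u, e⟫_ℂ = 0) → (∀ u ∈ S, ⟪u, f⟫_ℂ = 0) →
      ⟪f, e⟫_ℂ = 0 → ‖⟪f, a e⟫_ℂ‖ ≤ ε * ‖e‖ * ‖f‖ := by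
  classical
  by_contra! hcon
  obtain ⟨x, hx1, hx2⟩ := exists_seq_of_forall_finset_exists
    (fun x : H × H => ‖x.1‖ = 1 ∧ ‖x.2‖ = 1 ∧ ⟪x.2, x.1⟫_ℂ = 0 ∧ ε ≤ ‖⟪x.2, a x.1⟫_ℂ‖)
    -- Orthogonality to a e_m and a⋆f_m makes the matrix ⟪f_m, a e_n⟫ vanish on both sides of the
    -- diagonal.
    (fun x y => ∀ u ∈ ({x.1, x.2, a x.1, star a x.2} : Finset H),
      ⟪u, y.1⟫_ℂ = 0 ∧ ⟪u, y.2⟫_ℂ = 0) (fun S _ => by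
      obtain ⟨e, f, he, hf, hfe, hlt⟩ :=
        hcon (S.biUnion fun x => ({x.1, x.2, a x.1, star a x.2} : Finset H))
      have he0 : 0 < ‖e‖ := by
        rw [norm_pos_iff]
        rintro rfl
        simp at hlt
      have hf0 : 0 < ‖f‖ := by
        rw [norm_pos_iff]
        rintro rfl
        simp at hlt
      refine ⟨(((‖e‖⁻¹ : ℝ) : ℂ) • e, ((‖f‖⁻¹ : ℝ) : ℂ) • f), ⟨?_, ?_, ?_, ?_⟩, ?_⟩
      · simp [norm_smul, he0.ne']
      · simp [norm_smul, hf0.ne']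
      · simp [hfe]
      · simp only [map_smul, inner_smul_left, inner_smul_right, norm_mul, Complex.conj_ofReal,
          Complex.norm_real, norm_inv, norm_norm]
        rw [← mul_assoc, ← mul_inv, inv_mul_eq_div, le_div_iff₀ (by positivity), ← mul_assoc]
        linarith
      · intro x hx u hu
        have hu' : u ∈ S.biUnion fun x => ({x.1, x.2, a x.1, star a x.2} : Finset H) :=
          Finset.mem_biUnion.mpr ⟨x, hx, hu⟩
        simp [he u hu', hf u hu'])
  have horth : ∀ m n, m < n → ⟪(x m).1, (x n).1⟫_ℂ = 0 ∧ ⟪(x m).2, (x n).2⟫_ℂ = 0 ∧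
      ⟪(x m).1, (x n).2⟫_ℂ = 0 ∧ ⟪(x m).2, (x n).1⟫_ℂ = 0 ∧ ⟪a (x m).1, (x n).2⟫_ℂ = 0 ∧
      ⟪star a (x m).2, (x n).1⟫_ℂ = 0 := by
    intro m n hmn
    have h := hx2 m n hmn
    exact ⟨(h _ (by simp)).1, (h _ (by simp)).2, (h _ (by simp)).2, (h _ (by simp)).1,
      (h _ (by simp)).2, (h _ (by simp)).1⟩
  refine not_biorthogonal_of_commutator hp hq hr hpqr hcomm (e := fun n => (x n).1)
    (f := fun n => (x n).2) ⟨fun n => (hx1 n).1, fun m n hmn => ?_⟩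
    ⟨fun n => (hx1 n).2.1, fun m n hmn => ?_⟩ (fun m n => ?_) (fun m n hmn => ?_) hε
    (fun n => (hx1 n).2.2.2)
  · rcases hmn.lt_or_gt with h | h
    · exact (horth _ _ h).1
    · exact inner_eq_zero_symm.mp (horth _ _ h).1
  · rcases hmn.lt_or_gt with h | h
    · exact (horth _ _ h).2.1
    · exact inner_eq_zero_symm.mp (horth _ _ h).2.1
  · rcases lt_trichotomy m n with h | rfl | h
    · exact (horth _ _ h).2.2.2.1
    · exact (hx1 m).2.2.1
    · exact inner_eq_zero_symm.mp (horth _ _ h).2.2.1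
  · rcases hmn.lt_or_gt with h | h
    · rw [← ContinuousLinearMap.adjoint_inner_left]
      exact (horth _ _ h).2.2.2.2.2
    · exact inner_eq_zero_symm.mp (horth _ _ h).2.2.2.2.1

/-- The approximating scalars are bounded by ‖a‖. Along a subsequence they converge to some l₀, and
a − l₀ is then a norm limit of compact operators. -/
theorem exists_isCompactOperator_sub_smul (hH : ¬ FiniteDimensional ℂ H) {p q r : ℝ} (hp : 0 < p)
    (hq : 0 < q) (hr : 0 < r) (hpqr : 1 / q = 1 / r - 1 / p) {a : H →L[ℂ] H}
    (hcomm : ∀ x, IsSchatten p x → IsSchatten r (a * x - x * a)) :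
    ∃ l : ℂ, IsCompactOperator (a - l • 1 : H →L[ℂ] H) := by
  have hstep : ∀ n : ℕ, ∃ (l : ℂ) (k : H →L[ℂ] H), ‖l‖ ≤ ‖a‖ ∧ IsCompactOperator k ∧
      ‖a - l • 1 - k‖ ≤ 7 * (1 / ((n : ℝ) + 1)) := by
    intro n
    have hε : 0 < 1 / ((n : ℝ) + 1) := by positivity
    obtain ⟨S, hS⟩ := exists_finset_forall_norm_inner_le hp hq hr hpqr hcomm hε
    exact exists_norm_sub_smul_sub_le hH hε hS
  choose l k hl hk hlk using hstep
  obtain ⟨l₀, -, φ, hφ, hl₀⟩ := (isCompact_closedBall (0 : ℂ) ‖a‖).tendsto_subseq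
    (x := l) (fun n => by simpa using hl n)
  refine ⟨l₀, isCompactOperator_of_tendsto (F := fun n => k (φ n)) (l := Filter.atTop) ?_
    (Filter.Eventually.of_forall fun n => hk (φ n))⟩
  rw [tendsto_iff_norm_sub_tendsto_zero]
  have h1 : Filter.Tendsto (fun n => 7 * (1 / ((φ n : ℝ) + 1))) Filter.atTop (nhds 0) := by
    simpa using (tendsto_one_div_add_atTop_nhds_zero_nat.comp hφ.tendsto_atTop).const_mul (7 : ℝ)
  have h2 : Filter.Tendsto (fun n => ‖l (φ n) - l₀‖ * ‖(1 : H →L[ℂ] H)‖) Filter.atTop (nhds 0) := by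
    simpa using ((tendsto_iff_norm_sub_tendsto_zero.mp hl₀).mul_const ‖(1 : H →L[ℂ] H)‖)
  refine squeeze_zero (fun _ => norm_nonneg _) (fun n => ?_)
    (by simpa only [add_zero] using h1.add h2)
  have e1 : k (φ n) - (a - l₀ • 1) =
      -(a - l (φ n) • 1 - k (φ n)) - (l (φ n) - l₀) • (1 : H →L[ℂ] H) := by
    rw [sub_smul]
    abel
  rw [e1]
  refine (norm_sub_le _ _).trans (add_le_add ?_ (norm_smul_le _ _))
  rw [norm_neg]
  exact hlk (φ n)

theorem exists_isSchatten_sub_smul (hH : ¬ FiniteDimensional ℂ H) {p q r : ℝ} (hp : 0 < p)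
    (hq : 0 < q) (hr : 0 < r) (hpqr : 1 / q = 1 / r - 1 / p) {a : H →L[ℂ] H}
    (hcomm : ∀ x, IsSchatten p x → IsSchatten r (a * x - x * a)) :
    ∃ l : ℂ, IsSchatten q (a - l • 1) := by
  obtain ⟨l, hl⟩ := exists_isCompactOperator_sub_smul hH hp hq hr hpqr hcomm
  refine ⟨l, isSchatten_of_commutator_of_isCompactOperator hH hp hq hr hpqr hl (fun x hx => ?_)⟩
  have : (a - l • 1) * x - x * (a - l • 1) = a * x - x * a := by
    simp only [sub_mul, mul_sub, smul_mul_assoc, mul_smul_comm, one_mul, mul_one]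
    abel
  rw [this]
  exact hcomm x hx

end Schatten
theorem corollary3p6 {H : Type*} [NormedAddCommGroup H] [InnerProductSpace ℂ H] [CompleteSpace H]
    (hH : ¬ FiniteDimensional ℂ H) (p r : ℝ) (hp : 0 < p) (hr : 0 < r) :
    (p ≤ r →
      ∀ δ : schattenIdeal H p hp → (H →L[ℂ] H),
        IsDerivation (schattenIdeal H p hp) (schattenIdeal H r hr) δ ↔
          ∃ a : H →L[ℂ] H, ∀ x : schattenIdeal H p hp, δ x = a * x - x * a) ∧
    (r < p →
      ∀ (q : ℝ) (hq : 0 < q), 1 / q = 1 / r - 1 / p →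
        ∀ δ : schattenIdeal H p hp → (H →L[ℂ] H),
          IsDerivation (schattenIdeal H p hp) (schattenIdeal H r hr) δ ↔
            ∃ a : schattenIdeal H q hq, ∀ x : schattenIdeal H p hp,
              δ x = (a : H →L[ℂ] H) * x - x * (a : H →L[ℂ] H)) := by

  have : Nontrivial H := by
    by_contra h
    rw [not_nontrivial_iff_subsingleton] at h
    exact hH inferInstance
  refine ⟨fun hpr δ => ⟨fun hδ => Schatten.exists_eq_commutator hp hδ, ?_⟩,
    fun _ q hq hpqr δ => ⟨fun hδ => ?_, ?_⟩⟩
  · rintro ⟨a, ha⟩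
    refine Schatten.isDerivation_commutator a ha (fun x => ?_)
    have hx : (x : H →L[ℂ] H) ∈ (schattenIdeal H r hr).toSubmodule :=
      Schatten.IsSchatten.mono hp hpr x.2
    exact Submodule.sub_mem _ ((schattenIdeal H r hr).mul_mem_left a hx)
      ((schattenIdeal H r hr).mul_mem_right a hx)
  · obtain ⟨a, ha⟩ := Schatten.exists_eq_commutator hp hδ
    obtain ⟨l, hl⟩ := Schatten.exists_isSchatten_sub_smul hH hp hq hr hpqr (a := a)
      (fun x hx => by
        have := hδ.map_mem ⟨x, hx⟩
        rwa [ha] at this)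
    refine ⟨⟨a - l • 1, hl⟩, fun x => ?_⟩
    rw [ha]
    simp only [sub_mul, mul_sub, smul_mul_assoc, mul_smul_comm, one_mul, mul_one]
    abel
  · rintro ⟨a, ha⟩
    refine Schatten.isDerivation_commutator (a : H →L[ℂ] H) ha (fun x => ?_)
    have h1 : (a : H →L[ℂ] H) * x ∈ (schattenIdeal H r hr).toSubmodule :=
      Schatten.IsSchatten.mul hp hq hr hpqr a.2 x.2
    -- The exponent relation is symmetric in p and q.
    have h2 : (x : H →L[ℂ] H) * a ∈ (schattenIdeal H r hr).toSubmodule :=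
      Schatten.IsSchatten.mul hq hp hr (by linarith) x.2 a.2
    exact Submodule.sub_mem _ h1 h2
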